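/- **Setting.** A network of $n\ge 1$ agents acts at iterations $t=1,2,\dots$. The decision set $\mathbb X\subseteq\mathbb R^p$ is closed and convex, with $\|x\|\le R$ for all $x\in\mathbb X$. Agent $i$ has local losses $f_{i,t}:\mathbb X\to\mathbb R$ (possibly nonconvex) and local constraint functions $g_{i,t}:\mathbb X\to\mathbb R^{m_i}$ with convex components. For each $x\in\mathbb X$, $\nabla f_{i,t}(x)$ is a (limiting) subgradient of $f_{i,t}$ at $x$, and $\nabla g_{i,t}(x)$ is an $m_i\times p$ matrix whose rows are subgradients of the components of $g_{i,t}$ at $x$, depending measurably on $x$. Put $f_t=\frac1n\sum_j f_{j,t}$, $\nabla f_t=\frac1n\sum_j\nabla f_{j,t}$, $g_t=\mathrm{col}(g_{1,t},\dots,g_{n,t})$ and $\mathcal X_T=\{x\in\mathbb X: g_t(x)\le 0,\ 1\le t\le T\}$, and let $[\cdot]_+$ be the componentwise positive part and $\mathcal P_{\mathbb X}$ the Euclidean projection onto $\mathbb X$. **Assumptions.** For all $i$, all $t\ge1$ and all $x,y\in\mathbb X$: 1. $\|\nabla f_{i,t}(x)\|\le G_1$, $\|\nabla g_{i,t}(x)\|\le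 G_2$ (spectral norm) and $\|\nabla f_{i,t}(x)-\nabla f_{i,t}(y)\|\le L\|x-y\|$. 2. $\mathcal X_T\neq\emptyset$ for all $T\ge1$. 3. $\mathcal G_t=([n],\mathcal E_t)$ are directed graphs with mixing matrices $W_t$ whose rows and columns sum to $1$; $[W_t]_{ij}\ge w$ if $(j,i)\in\mathcal E_t$ or $i=j$, and $[W_t]_{ij}=0$ otherwise, where $w\in(0,1)$; and for some fixed integer $B>0$ the graph $([n],\bigcup_{l=0}^{B-1}\mathcal E_{t+l})$ is strongly connected for every $t\ge 1$. 4. $\mathcal C$ is a random operator on $\mathbb R^p$ with $\mathbf E[\|\mathcal C(x)-x\|_d^2]\le C$ for all $x\in\mathbb R^p$, for some $d\in[1,\infty]$ and $C\ge0$. Its internal randomness at iteration $t$ is independent of that of the earlier iterations. **Algorithm.** Let $\hat z_{i,0}=0$ and let $z_{i,1}\in\mathbb X$ be given (deterministic). For $t\ge1$ and all $i$, $$\hat z_{i,t}=\mathcal P_{\mathbb X}\big(\hat z_{i,t-1}+s_t\,\mathcal C((z_{i,t}-\hat z_{i,t-1})/s_t)\big),\qquad x_{i,t}=\sum_j[W_t]_{ij}\hat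 z_{j,t},\qquad v_{i,t+1}=\gamma_t[g_{i,t}(x_{i,t})]_+,$$ $$\omega_{i,t+1}=\nabla f_{i,t}(x_{i,t})+(\nabla g_{i,t}(x_{i,t}))^{T}v_{i,t+1},\qquad z_{i,t+1}=\mathcal P_{\mathbb X}(x_{i,t}-\alpha_t\omega_{i,t+1}).$$ **Theorem.** Let $\Psi_t=\sum_{k=1}^t\mu^k$ and run the algorithm with $\alpha_t=\alpha_0\sqrt{\Psi_t/t}$, $\gamma_t=\gamma_0/\alpha_t$ and $s_t=s_0\mu^t$, where $\alpha_0,s_0>0$, $\mu\in(0,1)$, $\gamma_0>0$ and $4G_2^2\gamma_0\le1$. Define $$\mathrm{Net\text{-}Reg}(T)=\frac1n\sum_{i=1}^n\Big(\sum_{t=1}^T\langle\nabla f_t(x_{i,t}),x_{i,t}\rangle-\inf_{x\in\mathcal X_T}\Big\langle\sum_{t=1}^T\nabla f_t(x_{i,t}),x\Big\rangle\Big),\qquad \mathrm{Net\text{-}CCV}(T)=\frac1n\sum_{i=1}^n\sum_{t=1}^T\|[g_t(x_{i,t})]_+\|.$$ Both are integrable, and there are constants $K_1,K_2$, depending only on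 $n,p,(m_i),R,G_1,G_2,L,w,B,d,C,\alpha_0,\gamma_0,s_0,\mu$, such that for every $T\ge1$ $$\mathbf E[\mathrm{Net\text{-}Reg}(T)]\le K_1\sqrt T,\qquad \mathbf E[\mathrm{Net\text{-}CCV}(T)]\le K_2T^{3/4}.$$ If moreover Slater's condition holds, i.e. there are $x_s\in\mathbb X$ and $\varsigma>0$ such that every component of $g_t(x_s)$ is at most $-\varsigma$ for all $t\ge1$, then $\mathbf E[\mathrm{Net\text{-}CCV}(T)]\le K_3\sqrt T$ for every $T\ge1$, where $K_3$ depends only on the same constants and $\varsigma$. -/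

import Mathlib

open MeasureTheory ProbabilityTheory Filter Topology
open scoped ENNReal InnerProductSpace

noncomputable section

namespace OnlineOpt

/-- `ℝᵖ` with the Euclidean norm and standard inner product. -/
abbrev E (p : ℕ) := EuclideanSpace ℝ (Fin p)

/-- The `d`-norm of a vector, `d ∈ [1, ∞]`. -/
def vecNorm {p : ℕ} (d : ℝ≥0∞) (x : E p) : ℝ :=
  ‖(WithLp.toLp d (fun k => x k) : PiLp d (fun _ : Fin p => ℝ))‖

/-- Projection onto the nonnegative orthant, `[x]₊`. -/
def posVec {ι : Type*} (x : EuclideanSpace ℝ ι) : EuclideanSpace ℝ ι :=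
  WithLp.toLp 2 (fun k => max (x k) 0)

/-- `y` minimizes the distance to `x` over the set `K`. -/
def IsProj {p : ℕ} (K : Set (E p)) (x y : E p) : Prop :=
  y ∈ K ∧ ∀ u ∈ K, ‖x - y‖ ≤ ‖x - u‖

/-- The projection of `x` onto `K` (the unique minimizer if `K` is nonempty, closed and convex). -/
def setProj {p : ℕ} (K : Set (E p)) (x : E p) : E p :=
  Classical.epsilon (IsProj K x)

/-- `v` is a regular (Fréchet) subgradient at `x` of the function `f` on the set `K`:
`f y ≥ f x + ⟪v, y - x⟫ + o(‖y - x‖)` as `y → x` in `K`. -/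
def IsRegularSubgradient {p : ℕ} (K : Set (E p)) (f : E p → ℝ) (x v : E p) : Prop :=
  x ∈ K ∧ ∀ ε > 0, ∀ᶠ y in 𝓝[K] x, f x + ⟪v, y - x⟫_ℝ - ε * ‖y - x‖ ≤ f y

/-- `v` is a (general, or limiting) subgradient at `x` of the not necessarily convex function `f`
on `K`: a limit of regular subgradients at points `u k → x` with `f (u k) → f x`.
Gradients of differentiable functions and subgradients of convex functions are of this form. -/
def IsSubgradient {p : ℕ} (K : Set (E p)) (f : E p → ℝ) (x v : E p) : Prop :=
  x ∈ K ∧ ∃ u r : ℕ → E p, (∀ k, IsRegularSubgradient K f (u k) (r k)) ∧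
    Tendsto u atTop (𝓝 x) ∧ Tendsto (fun k => f (u k)) atTop (𝓝 (f x)) ∧
    Tendsto r atTop (𝓝 v)

/-- The data of a distributed online problem with `n` agents in `ℝᵖ`. Functions are total and only
their values on `X` and at iterations `t ≥ 1` are used. `gradf i t x` is the subgradient of
`f i t` at `x` that agent `i` observes, and `gradg i t x` is the `m i × p` matrix, as a linear map,
whose rows are the observed subgradients of the components of `g i t` at `x`. -/
structure Problem (n p : ℕ) (m : Fin n → ℕ) where
  X : Set (E p)
  f : Fin n → ℕ → E p → ℝ
  gradf : Fin n → ℕ → E p → E p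
  g : (i : Fin n) → ℕ → E p → E (m i)
  gradg : (i : Fin n) → ℕ → E p → (E p →L[ℝ] E (m i))

namespace Problem

variable {n p : ℕ} {m : Fin n → ℕ} (Q : Problem n p m)

/-- The subgradient `∇f_t = (1/n) ∑ⱼ ∇f_{j,t}` of the global loss `f_t = (1/n) ∑ⱼ f_{j,t}`. -/
def globalGrad (t : ℕ) (x : E p) : E p :=
  (1 / (n : ℝ)) • ∑ j, Q.gradf j t x

/-- The global constraint `g_t = col (g_{1,t}, …, g_{n,t})`. -/
def globalConstraint (t : ℕ) (x : E p) : EuclideanSpace ℝ (Σ i : Fin n, Fin (m i)) :=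
  WithLp.toLp 2 (fun k => Q.g k.1 t x k.2)

/-- The feasible set `𝒳_T`. -/
def feasible (T : ℕ) : Set (E p) :=
  {x | x ∈ Q.X ∧ ∀ t, 1 ≤ t → t ≤ T → ∀ k, Q.globalConstraint t x k ≤ 0}

/-- Network regret of the decisions `x i t` after `T` iterations. -/
def netReg (x : Fin n → ℕ → E p) (T : ℕ) : ℝ :=
  (1 / (n : ℝ)) * ∑ i, ((∑ t ∈ Finset.Icc 1 T, ⟪Q.globalGrad t (x i t), x i t⟫_ℝ) -
    ⨅ y : Q.feasible T, ⟪∑ t ∈ Finset.Icc 1 T, Q.globalGrad t (x i t), (y : E p)⟫_ℝ)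

/-- Network cumulative constraint violation of the decisions `x i t` after `T` iterations. -/
def netCCV (x : Fin n → ℕ → E p) (T : ℕ) : ℝ :=
  (1 / (n : ℝ)) * ∑ i, ∑ t ∈ Finset.Icc 1 T, ‖posVec (Q.globalConstraint t (x i t))‖

/-- The decision set is convex, closed, and bounded by `R`. -/
structure DecisionSet (R : ℝ) : Prop where
  convex : Convex ℝ Q.X
  closed : IsClosed Q.X
  bounded : ∀ x ∈ Q.X, ‖x‖ ≤ R

/-- The constraint functions are convex, the observed vectors are subgradients, and these are
bounded by `G₁` and `G₂` (the latter in the spectral norm). Measurability of `gradg` makes the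
algorithm's iterates random variables. -/
structure Subgradients (G₁ G₂ : ℝ) : Prop where
  convex : ∀ i t, 1 ≤ t → ∀ k, ConvexOn ℝ Q.X (fun x => Q.g i t x k)
  subgrad_f : ∀ i t, 1 ≤ t → ∀ x ∈ Q.X, IsSubgradient Q.X (Q.f i t) x (Q.gradf i t x)
  subgrad_g : ∀ i t, 1 ≤ t → ∀ x ∈ Q.X, ∀ y ∈ Q.X, ∀ k,
    Q.g i t x k + Q.gradg i t x (y - x) k ≤ Q.g i t y k
  bound_f : ∀ i t, 1 ≤ t → ∀ x ∈ Q.X, ‖Q.gradf i t x‖ ≤ G₁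
  bound_g : ∀ i t, 1 ≤ t → ∀ x ∈ Q.X, ‖Q.gradg i t x‖ ≤ G₂
  measurable_g : ∀ i t, 1 ≤ t → ∀ u : E p, Measurable (fun x : Q.X => Q.gradg i t x u)

/-- The loss subgradients are Lipschitz on the decision set with constant `L`. -/
def LipschitzGrad (L : ℝ) : Prop :=
  ∀ i t, 1 ≤ t → ∀ x ∈ Q.X, ∀ y ∈ Q.X, ‖Q.gradf i t x - Q.gradf i t y‖ ≤ L * ‖x - y‖

/-- Slater's condition with constant `ς`. -/
def Slater (ς : ℝ) : Prop :=
  ∃ xs ∈ Q.X, ∀ t, 1 ≤ t → ∀ k, Q.globalConstraint t xs k ≤ -ς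

end Problem

/-- The digraph contains a directed path from every vertex to every vertex. -/
def StronglyConnected {V : Type*} (G : Digraph V) : Prop :=
  ∀ a b, Relation.ReflTransGen G.Adj a b

/-- Time-varying directed graphs `G t` with doubly stochastic mixing matrices `W t`, weights on
edges and on the diagonal at least `w`, and unions over `B` consecutive iterations strongly
connected. `(G t).Adj j i` says that agent `i` can receive information from agent `j`. -/
structure Network {n : ℕ} (G : ℕ → Digraph (Fin n)) (W : ℕ → Matrix (Fin n) (Fin n) ℝ)
    (w : ℝ) (B : ℕ) : Prop where
  weight_ge : ∀ t, 1 ≤ t → ∀ i j, ((G t).Adj j i ∨ i = j) → w ≤ W t i j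
  weight_zero : ∀ t, 1 ≤ t → ∀ i j, ¬ ((G t).Adj j i ∨ i = j) → W t i j = 0
  row_sum : ∀ t, 1 ≤ t → ∀ i, ∑ j, W t i j = 1
  col_sum : ∀ t, 1 ≤ t → ∀ j, ∑ i, W t i j = 1
  connected : ∀ t, 1 ≤ t → StronglyConnected (⨆ l : Fin B, G (t + l))

/-- A stochastic compressor `𝒞 x = comp x θ` with internal randomness `θ ∼ ν`, whose mean squared
error in the `d`-norm is at most `C` at every input. -/
structure Compressor {p : ℕ} {Θ : Type*} [MeasurableSpace Θ] (comp : E p → Θ → E p)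
    (ν : Measure Θ) (d : ℝ≥0∞) (C : ℝ) : Prop where
  measurable : Measurable (Function.uncurry comp)
  error : ∀ x, ∫⁻ θ, ENNReal.ofReal (vecNorm d (comp x θ - x) ^ 2) ∂ν ≤ ENNReal.ofReal C

/-- `ξ i t` is the internal randomness of the compressor when agent `i` uses it at iteration `t`:
it has law `ν`, and it is independent of the randomness of all earlier iterations. -/
structure FreshRandomness {n : ℕ} {Ω Θ : Type*} [MeasurableSpace Ω] [MeasurableSpace Θ]
    (P : Measure Ω) (ν : Measure Θ) (ξ : Fin n → ℕ → Ω → Θ) : Prop where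
  measurable : ∀ i t, Measurable (ξ i t)
  law : ∀ i t, 1 ≤ t → P.map (ξ i t) = ν
  indep : ∀ i t, 1 ≤ t →
    IndepFun (ξ i t) (fun ω (q : Fin n × Finset.Ico 1 t) => ξ q.1 q.2 ω) P

/-- One run of the compressed primal-dual algorithm with stepsizes `α`, regularization parameters
`γ`, scaling parameters `s`, initial points `z₁`, and compressor randomness `θ i t`.
The sequences are `z`, `ẑ`, `x`, the dual variables `v`, and the directions `dir` (written `ω` in formulas). -/
structure IsRun {n p : ℕ} {m : Fin n → ℕ} (Q : Problem n p m)
    (W : ℕ → Matrix (Fin n) (Fin n) ℝ) {Θ : Type*} (comp : E p → Θ → E p)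
    (α γ s : ℕ → ℝ) (z₁ : Fin n → E p) (θ : Fin n → ℕ → Θ)
    (z zhat x : Fin n → ℕ → E p) (v : (i : Fin n) → ℕ → E (m i)) (dir : Fin n → ℕ → E p) :
    Prop where
  zhat_zero : ∀ j, zhat j 0 = 0
  z_one : ∀ i, z i 1 = z₁ i
  zhat_step : ∀ j t, 1 ≤ t → zhat j t = setProj Q.X
    (zhat j (t - 1) + s t • comp ((s t)⁻¹ • (z j t - zhat j (t - 1))) (θ j t))
  x_step : ∀ i t, 1 ≤ t → x i t = ∑ j, W t i j • zhat j t
  v_step : ∀ i t, 1 ≤ t → v i (t + 1) = γ t • posVec (Q.g i t (x i t))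
  dir_step : ∀ i t, 1 ≤ t → dir i (t + 1) =
    Q.gradf i t (x i t) + (Q.gradg i t (x i t)).adjoint (v i (t + 1))
  z_step : ∀ i t, 1 ≤ t → z i (t + 1) = setProj Q.X (x i t - α t • dir i (t + 1))

/-- `x` is the decision sequence that the algorithm outputs. -/
def IsOutput {n p : ℕ} {m : Fin n → ℕ} (Q : Problem n p m)
    (W : ℕ → Matrix (Fin n) (Fin n) ℝ) {Θ : Type*} (comp : E p → Θ → E p)
    (α γ s : ℕ → ℝ) (z₁ : Fin n → E p) (θ : Fin n → ℕ → Θ) (x : Fin n → ℕ → E p) : Prop :=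
  ∃ z zhat v dir, IsRun Q W comp α γ s z₁ θ z zhat x v dir

/-- The stepsize `α₀ √(Ψ_t / t)` with `Ψ_t = ∑_{k=1}^t μᵏ`. -/
def stepsize (α₀ μ : ℝ) (t : ℕ) : ℝ :=
  α₀ * √((∑ k ∈ Finset.Icc 1 t, μ ^ k) / t)

end OnlineOpt

end

open OnlineOpt

/-!
The compressor errors are harmless because the scaling `s_t = s₀ μᵗ` decays geometrically. The
point `z_{i,t}` lies in the decision set, so projecting can only bring `ẑ_{i,t}` closer to it, and
`‖ẑ_{i,t} - z_{i,t}‖` is at most `s_t` times the error of the compressor at an input that depends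
on the earlier randomness only. That randomness is independent of the fresh one, so the expectation
is `O(μᵗ)` (`Compressor.lintegral_le`, `integral_norm_zhat_sub_z_le`) and the total error `D`,
`totalError`, has bounded expectation. It remains to prove, for every single run, bounds of the
form `(b + b' D) r(T)` with deterministic `b`, `b'` (`exists_netReg_le`, `exists_netCCV_le`,
`exists_netCCV_le_of_slater`), and to integrate them.

Along a run, `α_t γ_t = γ₀` makes the dual variable a penalty of constant weight `γ₀`. With
`q = ‖[g_{i,t}(x_{i,t})]₊‖` and a point `y` at which all constraints are at most `-c`, convexity
gives

`‖z_{i,t+1} - y‖² ≤ ‖x_{i,t} - y‖² - 2 α_t ⟪∇f, x_{i,t} - y⟫ + 2 α_t² G₁² - (3/2) γ₀ q² - 2 γ₀ c q`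

(`PrimalPath.norm_z_succ_sub_sq_le`), where `4 G₂² γ₀ ≤ 1` absorbs the square of the penalty step.
Doubly stochastic mixing does not increase the sum over the agents, so this can be used in two ways.

* Summed as it stands, with `∑ α_t = O(√T)`, it yields `∑ q² = O(√T)`, hence `∑ q = O(T ^ (3/4))`,
  and under Slater's condition, with `c = ς`, even `∑ q = O(√T)`.
* Divided by `α_t` and summed by parts, it bounds the regret of the agents for their own losses by
  `O(1 / α_T + ∑ α_t) = O(√T)`, and leaves over the negative term `-∑ q² / α_t`.

Passing to global losses and constraints costs the disagreement of the agents. Over `n B` iterations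
every entry of the product of the mixing matrices becomes at least `w ^ (n B)`, so the diameter of
the agents' points contracts (`spread_add_le`), and the total disagreement is at most a multiple of
`1 + ∑ (α_t + q) + D` (`sum_spread_le`). In the regret, the term `∑ q` is absorbed by
`-∑ q² / α_t` at the price of another `O(∑ α_t)`.
-/

noncomputable section

namespace OnlineOpt

/-! ### Projections, positive parts and norms -/

section Projection

variable {p : ℕ} {K : Set (E p)}

theorem isProj_setProj (hne : K.Nonempty) (hcl : IsClosed K) (hco : Convex ℝ K) (x : E p) :
    IsProj K x (setProj K x) := by
  apply Classical.epsilon_spec (p := IsProj K x)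
  obtain ⟨y, hy, hmin⟩ := exists_norm_eq_iInf_of_complete_convex hne hcl.isComplete hco x
  refine ⟨y, hy, fun u hu => ?_⟩
  rw [hmin]
  exact ciInf_le ⟨0, by rintro _ ⟨z, rfl⟩; exact norm_nonneg _⟩ (⟨u, hu⟩ : K)

theorem setProj_mem (hne : K.Nonempty) (hcl : IsClosed K) (hco : Convex ℝ K) (x : E p) :
    setProj K x ∈ K :=
  (isProj_setProj hne hcl hco x).1

theorem inner_sub_setProj_le_zero (hcl : IsClosed K) (hco : Convex ℝ K) (x : E p) {u : E p}
    (hu : u ∈ K) : ⟪x - setProj K x, u - setProj K x⟫_ℝ ≤ 0 := by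
  obtain ⟨hmem, hmin⟩ := isProj_setProj ⟨u, hu⟩ hcl hco x
  have : Nonempty K := ⟨⟨u, hu⟩⟩
  refine (norm_eq_iInf_iff_real_inner_le_zero hco hmem).1 ?_ u hu
  refine le_antisymm (le_ciInf fun w => hmin w w.2) ?_
  exact ciInf_le ⟨0, by rintro _ ⟨z, rfl⟩; exact norm_nonneg _⟩ (⟨setProj K x, hmem⟩ : K)

theorem norm_setProj_sub_setProj_le (hne : K.Nonempty) (hcl : IsClosed K) (hco : Convex ℝ K)
    (x y : E p) : ‖setProj K x - setProj K y‖ ≤ ‖x - y‖ := by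
  set a := setProj K x with ha
  set b := setProj K y with hb
  have h1 := inner_sub_setProj_le_zero hcl hco x (setProj_mem hne hcl hco y)
  have h2 := inner_sub_setProj_le_zero hcl hco y (setProj_mem hne hcl hco x)
  rw [← ha, ← hb] at h1 h2
  have h3 : ‖a - b‖ * ‖a - b‖ ≤ ⟪x - y, a - b⟫_ℝ := by
    rw [← real_inner_self_eq_norm_mul_norm]
    simp only [inner_sub_left, inner_sub_right] at h1 h2 ⊢
    linarith
  have h4 := real_inner_le_norm (x - y) (a - b)
  by_contra! hlt
  have hpos : 0 < ‖a - b‖ := (norm_nonneg _).trans_lt hlt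
  nlinarith

theorem setProj_eq_self (hcl : IsClosed K) (hco : Convex ℝ K) {x : E p} (hx : x ∈ K) :
    setProj K x = x := by
  have h := (isProj_setProj ⟨x, hx⟩ hcl hco x).2 x hx
  rw [sub_self, norm_zero] at h
  exact (sub_eq_zero.1 (norm_le_zero_iff.1 h)).symm

theorem norm_setProj_sub_le (hcl : IsClosed K) (hco : Convex ℝ K) (x : E p) {y : E p}
    (hy : y ∈ K) : ‖setProj K x - y‖ ≤ ‖x - y‖ := by
  simpa [setProj_eq_self hcl hco hy] using norm_setProj_sub_setProj_le ⟨y, hy⟩ hcl hco x y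

theorem measurable_setProj (hne : K.Nonempty) (hcl : IsClosed K) (hco : Convex ℝ K) :
    Measurable (setProj K) := by
  have : LipschitzWith 1 (setProj K) := LipschitzWith.of_dist_le_mul fun x y => by
    simpa [dist_eq_norm] using norm_setProj_sub_setProj_le hne hcl hco x y
  exact this.continuous.measurable

end Projection

section PosVec

variable {ι : Type*} [Fintype ι]

theorem norm_le_norm_of_abs_le {x y : EuclideanSpace ℝ ι} (h : ∀ k, |x k| ≤ |y k|) :
    ‖x‖ ≤ ‖y‖ := by
  rw [EuclideanSpace.norm_eq, EuclideanSpace.norm_eq]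
  refine Real.sqrt_le_sqrt (Finset.sum_le_sum fun k _ => ?_)
  simpa [sq_abs] using sq_le_sq.2 (h k)

theorem norm_posVec_le_of_le_add {x y e : EuclideanSpace ℝ ι} (h : ∀ k, x k ≤ y k + e k) :
    ‖posVec x‖ ≤ ‖posVec y‖ + ‖e‖ := by
  have h1 : ‖posVec e‖ ≤ ‖e‖ := by
    refine norm_le_norm_of_abs_le fun k => ?_
    simp only [posVec]
    rw [abs_of_nonneg (le_max_right _ _)]
    exact max_le (le_abs_self _) (abs_nonneg _)
  have h2 : ‖posVec x‖ ≤ ‖posVec y + posVec e‖ := by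
    refine norm_le_norm_of_abs_le fun k => ?_
    simp only [posVec, PiLp.add_apply]
    have hy := le_max_right (y k) 0
    have he := le_max_right (e k) 0
    rw [abs_of_nonneg (le_max_right _ _), abs_of_nonneg (add_nonneg hy he)]
    exact max_le ((h k).trans (add_le_add (le_max_left _ _) (le_max_left _ _)))
      (add_nonneg hy he)
  linarith [norm_add_le (posVec y) (posVec e)]

theorem norm_le_sum_abs (x : EuclideanSpace ℝ ι) : ‖x‖ ≤ ∑ k, |x k| := by
  rw [EuclideanSpace.norm_eq]
  refine Real.sqrt_le_iff.2 ⟨Finset.sum_nonneg fun k _ => abs_nonneg _, ?_⟩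
  simpa using Finset.sum_sq_le_sq_sum_of_nonneg (s := Finset.univ) (f := fun k => |x k|)
    (fun k _ => abs_nonneg _)

/-- A vector `h` that dominates `x + c` coordinatewise pairs with the positive part `[x]₊` to at
least `‖[x]₊‖² + c ‖[x]₊‖`. -/
theorem sq_add_mul_le_inner_posVec {x h : EuclideanSpace ℝ ι} {c : ℝ} (hc : 0 ≤ c)
    (hle : ∀ k, x k + c ≤ h k) :
    ‖posVec x‖ ^ 2 + c * ‖posVec x‖ ≤ ⟪posVec x, h⟫_ℝ := by
  have h1 : c * ‖posVec x‖ ≤ ∑ k, c * posVec x k := by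
    rw [← Finset.mul_sum]
    refine mul_le_mul_of_nonneg_left ((norm_le_sum_abs _).trans_eq ?_) hc
    exact Finset.sum_congr rfl fun k _ => abs_of_nonneg (le_max_right _ _)
  have h2 : ‖posVec x‖ ^ 2 = ∑ k, posVec x k * posVec x k := by
    rw [EuclideanSpace.norm_sq_eq]
    exact Finset.sum_congr rfl fun k _ => by simp [sq]
  have h3 : ⟪posVec x, h⟫_ℝ = ∑ k, posVec x k * h k := by
    simp [PiLp.inner_apply, mul_comm]
  rw [h2, h3]
  refine (add_le_add le_rfl h1).trans ?_
  rw [← Finset.sum_add_distrib]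
  refine Finset.sum_le_sum fun k _ => ?_
  have hk := hle k
  have : posVec x k = max (x k) 0 := rfl
  rw [this]
  rcases le_total (x k) 0 with h0 | h0
  · simp [h0]
  · rw [max_eq_left h0]; nlinarith

theorem measurable_posVec : Measurable (posVec : EuclideanSpace ℝ ι → EuclideanSpace ℝ ι) := by
  have : Continuous (posVec : EuclideanSpace ℝ ι → EuclideanSpace ℝ ι) := by
    unfold posVec; fun_prop
  exact this.measurable

end PosVec

/-- The positive part of the stacked vector is controlled by those of its blocks. -/
theorem norm_posVec_globalConstraint_le {n p : ℕ} {m : Fin n → ℕ} (Q : Problem n p m) (t : ℕ)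
    (x : E p) : ‖posVec (Q.globalConstraint t x)‖ ≤ ∑ j, ‖posVec (Q.g j t x)‖ := by
  refine (sq_le_sq₀ (norm_nonneg _) (Finset.sum_nonneg fun j _ => norm_nonneg _)).1 ?_
  refine le_trans (le_of_eq ?_) (Finset.sum_sq_le_sq_sum_of_nonneg
    (s := Finset.univ) (f := fun j => ‖posVec (Q.g j t x)‖) (fun j _ => norm_nonneg _))
  rw [EuclideanSpace.norm_sq_eq, Fintype.sum_sigma]
  exact Finset.sum_congr rfl fun j _ =>
    (EuclideanSpace.norm_sq_eq (posVec (Q.g j t x))).symm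

/-- Every coordinate is at most the `d`-norm, whatever `d`; the constant `p` is crude. -/
theorem norm_le_mul_vecNorm {p : ℕ} {d : ℝ≥0∞} (hd : 1 ≤ d) (x : E p) :
    ‖x‖ ≤ p * vecNorm d x := by
  have : Fact (1 ≤ d) := ⟨hd⟩
  refine (norm_le_sum_abs x).trans ?_
  have h : ∀ k, |x k| ≤ vecNorm d x := fun k =>
    PiLp.norm_apply_le (WithLp.toLp d (fun k => x k) : PiLp d (fun _ : Fin p => ℝ)) k
  simpa using Finset.sum_le_sum fun k (_ : k ∈ Finset.univ) => h k

/-! ### Consensus over time-varying digraphs -/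

section Consensus

variable {n : ℕ} {G : ℕ → Digraph (Fin n)} {W : ℕ → Matrix (Fin n) (Fin n) ℝ} {w : ℝ} {B : ℕ}

theorem Network.weight_nonneg (h : Network G W w B) (hw : 0 < w) {t : ℕ} (ht : 1 ≤ t)
    (i j : Fin n) : 0 ≤ W t i j := by
  by_cases hij : (G t).Adj j i ∨ i = j
  · exact hw.le.trans (h.weight_ge t ht i j hij)
  · exact (h.weight_zero t ht i j hij).ge

/-- The transition matrix `W (s + k - 1) ⋯ W (s + 1) W s` of `k` iterations starting at `s`. -/
def transition (W : ℕ → Matrix (Fin n) (Fin n) ℝ) (s : ℕ) : ℕ → Matrix (Fin n) (Fin n) ℝ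
  | 0 => 1
  | k + 1 => W (s + k) * transition W s k

theorem transition_nonneg (h : Network G W w B) (hw : 0 < w) {s : ℕ} (hs : 1 ≤ s) (k : ℕ)
    (i j : Fin n) : 0 ≤ transition W s k i j := by
  induction k generalizing i with
  | zero => simp only [transition, Matrix.one_apply]; split_ifs <;> norm_num
  | succ k ih =>
    rw [transition, Matrix.mul_apply]
    exact Finset.sum_nonneg fun l _ => mul_nonneg (h.weight_nonneg hw (by omega) i l) (ih l)

theorem transition_row_sum (h : Network G W w B) {s : ℕ} (hs : 1 ≤ s) (k : ℕ) (i : Fin n) :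
    ∑ j, transition W s k i j = 1 := by
  induction k generalizing i with
  | zero => simp [transition, Matrix.one_apply]
  | succ k ih =>
    simp only [transition, Matrix.mul_apply]
    rw [Finset.sum_comm]
    simp only [← Finset.mul_sum, ih, mul_one]
    exact h.row_sum _ (by omega) i

/-- The agents that, `k` iterations after `s`, have put weight at least `w ^ k` on the initial
value of agent `j`. -/
def influenced (W : ℕ → Matrix (Fin n) (Fin n) ℝ) (w : ℝ) (s : ℕ) (j : Fin n) (k : ℕ) :
    Finset (Fin n) :=
  {i | w ^ k ≤ transition W s k i j}

theorem mem_influenced_succ (h : Network G W w B) (hw : 0 < w) {s : ℕ} (hs : 1 ≤ s)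
    {j a b : Fin n} {k : ℕ} (ha : a ∈ influenced W w s j k)
    (hab : (G (s + k)).Adj a b ∨ b = a) : b ∈ influenced W w s j (k + 1) := by
  simp only [influenced, Finset.mem_filter, Finset.mem_univ, true_and] at ha ⊢
  rw [transition, Matrix.mul_apply, pow_succ']
  calc w * w ^ k ≤ W (s + k) b a * transition W s k a j :=
        mul_le_mul (h.weight_ge _ (by omega) b a hab) ha (by positivity)
          (h.weight_nonneg hw (by omega) b a)
    _ ≤ _ := Finset.single_le_sum (f := fun l => W (s + k) b l * transition W s k l j)
        (fun l _ => mul_nonneg (h.weight_nonneg hw (by omega) b l)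
          (transition_nonneg h hw hs k l j)) (Finset.mem_univ a)

theorem influenced_mono (h : Network G W w B) (hw : 0 < w) {s : ℕ} (hs : 1 ≤ s) (j : Fin n) :
    Monotone (influenced W w s j) :=
  monotone_nat_of_le_succ fun _ _ ha => mem_influenced_succ h hw hs ha (Or.inr rfl)

/-- During any `B` consecutive iterations the set of influenced agents grows until it is
everything: otherwise it would be closed under the edges of a strongly connected graph. -/
theorem influenced_ssubset (h : Network G W w B) (hw : 0 < w) {s : ℕ} (hs : 1 ≤ s) {j : Fin n}
    {k : ℕ} (hne : (influenced W w s j k).Nonempty) (huniv : influenced W w s j k ≠ Finset.univ) :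
    influenced W w s j k ⊂ influenced W w s j (k + B) := by
  refine (influenced_mono h hw hs j (Nat.le_add_right k B)).ssubset_of_not_subset fun hsub => ?_
  obtain ⟨a, ha⟩ := hne
  refine huniv (Finset.eq_univ_of_forall fun b => ?_)
  have hpath := h.connected (s + k) (by omega) a b
  induction hpath with
  | refl => exact ha
  | tail _ hadj ih =>
    rw [Digraph.iSup_adj] at hadj
    obtain ⟨l, hl⟩ := hadj
    have h1 := influenced_mono h hw hs j (Nat.le_add_right k l) ih
    have h2 := mem_influenced_succ h hw hs h1 (Or.inl (by rwa [← add_assoc]))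
    exact hsub (influenced_mono h hw hs j (by omega) h2)

theorem influenced_eq_univ (h : Network G W w B) (hw : 0 < w) {s : ℕ} (hs : 1 ≤ s) (j : Fin n) :
    influenced W w s j (n * B) = Finset.univ := by
  have key : ∀ q : ℕ, influenced W w s j (q * B) = Finset.univ ∨
      q + 1 ≤ (influenced W w s j (q * B)).card := by
    intro q
    induction q with
    | zero =>
      right
      refine Finset.card_pos.2 ⟨j, ?_⟩
      simp [influenced, transition]
    | succ q ih =>
      rw [Nat.succ_mul]
      by_cases hu : influenced W w s j (q * B) = Finset.univ
      · left
        exact Finset.univ_subset_iff.1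
          (hu ▸ influenced_mono h hw hs j (Nat.le_add_right (q * B) B))
      · right
        have hq := ih.resolve_left hu
        have := Finset.card_lt_card (influenced_ssubset h hw hs
          (Finset.card_pos.1 (by omega)) hu)
        omega
  refine (key n).resolve_right fun hcard => ?_
  have := Finset.card_le_univ (influenced W w s j (n * B))
  rw [Fintype.card_fin] at this
  omega

theorem pow_le_transition (h : Network G W w B) (hw : 0 < w) {s : ℕ} (hs : 1 ≤ s)
    (i j : Fin n) : w ^ (n * B) ≤ transition W s (n * B) i j := by
  have := influenced_eq_univ h hw hs j ▸ Finset.mem_univ i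
  simpa [influenced] using this

variable {F : Type*} [NormedAddCommGroup F]

/-- The diameter of a finite family of vectors. -/
def spread (u : Fin n → F) : ℝ := ⨆ q : Fin n × Fin n, ‖u q.1 - u q.2‖

theorem norm_sub_le_spread (u : Fin n → F) (i j : Fin n) : ‖u i - u j‖ ≤ spread u :=
  le_ciSup (f := fun q : Fin n × Fin n => ‖u q.1 - u q.2‖)
    (Set.finite_range _).bddAbove (i, j)

theorem spread_nonneg (u : Fin n → F) : 0 ≤ spread u :=
  Real.iSup_nonneg fun _ => norm_nonneg _

theorem spread_le {u : Fin n → F} {b : ℝ} (hb : 0 ≤ b) (h : ∀ i j, ‖u i - u j‖ ≤ b) :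
    spread u ≤ b :=
  Real.iSup_le (fun q => h q.1 q.2) hb

variable [NormedSpace ℝ F]

/-- Two averages of the same vectors, with weights at least `b`, differ by less than the diameter:
in the mean of `u j - u l` over independent `j` and `l`, the pairs with `j = l` contribute
nothing. -/
theorem norm_average_sub_average_le {a c : Fin n → ℝ} {b : ℝ} (hn : 0 < n) (hb : 0 ≤ b)
    (ha : ∀ j, b ≤ a j) (hc : ∀ j, b ≤ c j) (ha1 : ∑ j, a j = 1) (hc1 : ∑ j, c j = 1)
    (u : Fin n → F) :
    ‖∑ j, a j • u j - ∑ j, c j • u j‖ ≤ (1 - b ^ 2) * spread u := by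
  have ha0 : ∀ j, 0 ≤ a j := fun j => hb.trans (ha j)
  have hc0 : ∀ j, 0 ≤ c j := fun j => hb.trans (hc j)
  have h1 : ∑ j, a j • u j - ∑ j, c j • u j = ∑ j, ∑ l, (a j * c l) • (u j - u l) := by
    simp only [smul_sub, Finset.sum_sub_distrib]
    congr 1
    · refine Finset.sum_congr rfl fun j _ => ?_
      rw [← Finset.sum_smul, ← Finset.mul_sum, hc1, mul_one]
    · rw [Finset.sum_comm]
      refine Finset.sum_congr rfl fun l _ => ?_
      rw [← Finset.sum_smul, ← Finset.sum_mul, ha1, one_mul]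
  have h2 : ∀ j l, ‖(a j * c l) • (u j - u l)‖ ≤
      (a j * c l - if j = l then a j * c l else 0) * spread u := by
    intro j l
    rw [norm_smul, Real.norm_of_nonneg (mul_nonneg (ha0 j) (hc0 l))]
    split_ifs with hjl
    · simp [hjl]
    · rw [sub_zero]
      exact mul_le_mul_of_nonneg_left (norm_sub_le_spread u j l) (mul_nonneg (ha0 j) (hc0 l))
  rw [h1]
  calc _ ≤ ∑ j, ∑ l, (a j * c l - if j = l then a j * c l else 0) * spread u :=
        (norm_sum_le _ _).trans (Finset.sum_le_sum fun j _ =>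
          (norm_sum_le _ _).trans (Finset.sum_le_sum fun l _ => h2 j l))
    _ = (1 - ∑ j, a j * c j) * spread u := by
        simp only [← Finset.sum_mul, Finset.sum_sub_distrib, Finset.sum_ite_eq, Finset.mem_univ,
          if_true]
        rw [← Finset.sum_mul_sum, ha1, hc1, one_mul]
    _ ≤ _ := by
        refine mul_le_mul_of_nonneg_right ?_ (spread_nonneg u)
        have : b ^ 2 ≤ ∑ j, a j * c j := by
          calc b ^ 2 ≤ a ⟨0, hn⟩ * c ⟨0, hn⟩ := by
                rw [sq]; exact mul_le_mul (ha _) (hc _) hb (ha0 _)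
            _ ≤ _ := Finset.single_le_sum (f := fun j => a j * c j)
                (fun j _ => mul_nonneg (ha0 j) (hc0 j)) (Finset.mem_univ _)
        linarith

theorem norm_sub_transition_le (h : Network G W w B) (hw : 0 < w) {u : ℕ → Fin n → F}
    {e : ℕ → ℝ} (hu : ∀ t, 1 ≤ t → ∀ i, ‖u (t + 1) i - ∑ j, W t i j • u t j‖ ≤ e t)
    {s : ℕ} (hs : 1 ≤ s) (k : ℕ) (i : Fin n) :
    ‖u (s + k) i - ∑ j, transition W s k i j • u s j‖ ≤ ∑ l ∈ Finset.range k, e (s + l) := by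
  induction k generalizing i with
  | zero => simp [transition, Matrix.one_apply]
  | succ k ih =>
    rw [Finset.sum_range_succ]
    have h1 : ∑ j, transition W s (k + 1) i j • u s j =
        ∑ l, W (s + k) i l • ∑ j, transition W s k l j • u s j := by
      simp only [transition, Matrix.mul_apply, Finset.sum_smul, Finset.smul_sum, smul_smul]
      exact Finset.sum_comm
    have h2 : ‖∑ l, W (s + k) i l • u (s + k) l -
        ∑ l, W (s + k) i l • ∑ j, transition W s k l j • u s j‖ ≤
        ∑ l ∈ Finset.range k, e (s + l) := by
      rw [← Finset.sum_sub_distrib]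
      calc _ ≤ ∑ l, W (s + k) i l * ∑ l ∈ Finset.range k, e (s + l) := by
            refine (norm_sum_le _ _).trans (Finset.sum_le_sum fun l _ => ?_)
            rw [← smul_sub, norm_smul,
              Real.norm_of_nonneg (h.weight_nonneg hw (by omega) i l)]
            exact mul_le_mul_of_nonneg_left (ih l) (h.weight_nonneg hw (by omega) i l)
        _ = _ := by rw [← Finset.sum_mul, h.row_sum _ (by omega), one_mul]
    have h3 := hu (s + k) (by omega) i
    rw [h1]
    exact (norm_sub_le_norm_sub_add_norm_sub _ _ _).trans
      ((add_le_add h3 h2).trans_eq (add_comm _ _))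

/-- Over `n * B` iterations the diameter contracts, up to the accumulated perturbations. -/
theorem spread_add_le (h : Network G W w B) (hn : 0 < n) (hw : 0 < w) (hw1 : w ≤ 1)
    {u : ℕ → Fin n → F}
    {e : ℕ → ℝ} (hu : ∀ t, 1 ≤ t → ∀ i, ‖u (t + 1) i - ∑ j, W t i j • u t j‖ ≤ e t)
    {s : ℕ} (hs : 1 ≤ s) :
    spread (u (s + n * B)) ≤ (1 - (w ^ (n * B)) ^ 2) * spread (u s) +
      2 * ∑ l ∈ Finset.range (n * B), e (s + l) := by
  have hb : 0 ≤ w ^ (n * B) := by positivity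
  have hb1 : w ^ (n * B) ≤ 1 := pow_le_one₀ hw.le hw1
  have h1 := norm_sub_transition_le h hw hu hs (n * B)
  have hsum : 0 ≤ ∑ l ∈ Finset.range (n * B), e (s + l) :=
    (norm_nonneg _).trans (h1 ⟨0, hn⟩)
  refine spread_le (add_nonneg (mul_nonneg (by nlinarith) (spread_nonneg _)) (by linarith)) ?_
  intro i j
  have h2 := norm_average_sub_average_le hn hb (pow_le_transition h hw hs i)
    (pow_le_transition h hw hs j) (transition_row_sum h hs _ i) (transition_row_sum h hs _ j) (u s)
  have h3 := h1 i
  have h4 := h1 j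
  set A := ∑ l, transition W s (n * B) i l • u s l
  set A' := ∑ l, transition W s (n * B) j l • u s l
  have h5 : u (s + n * B) i - u (s + n * B) j =
      (u (s + n * B) i - A) + (A - A') - (u (s + n * B) j - A') := by abel
  rw [h5]
  have h6 := norm_sub_le ((u (s + n * B) i - A) + (A - A')) (u (s + n * B) j - A')
  have h7 := norm_add_le (u (s + n * B) i - A) (A - A')
  linarith

/-- The disagreement accumulated over `T` iterations is at most proportional to the accumulated
perturbations. -/
theorem sum_spread_le (h : Network G W w B) (hn : 0 < n) (hw : 0 < w) (hw1 : w ≤ 1)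
    {u : ℕ → Fin n → F} {e : ℕ → ℝ} (he : ∀ t, 1 ≤ t → 0 ≤ e t)
    (hu : ∀ t, 1 ≤ t → ∀ i, ‖u (t + 1) i - ∑ j, W t i j • u t j‖ ≤ e t)
    {b : ℝ} (hb : ∀ t, 1 ≤ t → spread (u t) ≤ b) (T : ℕ) :
    (w ^ (n * B)) ^ 2 * ∑ t ∈ Finset.range T, spread (u (t + 1)) ≤
      (n * B : ℕ) * (b + 2 * ∑ t ∈ Finset.range T, e (t + 1)) := by
  set N := n * B with hN
  set ε := (w ^ N) ^ 2 with hε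
  have hε1 : ε ≤ 1 := pow_le_one₀ (by positivity) (pow_le_one₀ hw.le hw1)
  have hε0 : 0 ≤ ε := by positivity
  have hb0 : 0 ≤ b := (spread_nonneg _).trans (hb 1 le_rfl)
  have hesum : ∀ S, 0 ≤ ∑ t ∈ Finset.range S, e (t + 1) :=
    fun S => Finset.sum_nonneg fun t _ => he _ (by omega)
  have hinit : ∀ S, ∑ t ∈ Finset.range S, spread (u (t + 1)) ≤ S * b := fun S => by
    simpa using Finset.sum_le_sum fun t (_ : t ∈ Finset.range S) => hb (t + 1) (by omega)
  have hpos : ∀ S, 0 ≤ ∑ t ∈ Finset.range S, spread (u (t + 1)) :=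
    fun S => Finset.sum_nonneg fun t _ => spread_nonneg _
  -- For `T ≤ N` the trivial bound `T * b` suffices; otherwise the first `N` terms are bounded
  -- trivially and the others by the contraction.
  rcases le_total T N with hT | hT
  · have h1 := hinit T
    have h2 : (T : ℝ) * b ≤ N * b := mul_le_mul_of_nonneg_right (by exact_mod_cast hT) hb0
    have h3 : 0 ≤ (N : ℝ) * (2 * ∑ t ∈ Finset.range T, e (t + 1)) :=
      mul_nonneg (Nat.cast_nonneg _) (mul_nonneg zero_le_two (hesum T))
    have h4 : ε * ∑ t ∈ Finset.range T, spread (u (t + 1)) ≤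
        ∑ t ∈ Finset.range T, spread (u (t + 1)) := mul_le_of_le_one_left (hpos T) hε1
    linarith
  · obtain ⟨S, rfl⟩ := Nat.exists_eq_add_of_le hT
    have hsplit := Finset.sum_range_add (fun t => spread (u (t + 1))) N S
    have hstep : ∑ t ∈ Finset.range S, spread (u (N + t + 1)) ≤
        (1 - ε) * ∑ t ∈ Finset.range S, spread (u (t + 1)) +
          2 * ∑ t ∈ Finset.range S, ∑ l ∈ Finset.range N, e (t + 1 + l) := by
      rw [Finset.mul_sum, Finset.mul_sum, ← Finset.sum_add_distrib]
      refine Finset.sum_le_sum fun t _ => ?_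
      have := spread_add_le h hn hw hw1 hu (s := t + 1) (by omega)
      rwa [show t + 1 + n * B = N + t + 1 by omega] at this
    have hsub : ∑ t ∈ Finset.range S, spread (u (t + 1)) ≤
        ∑ t ∈ Finset.range (N + S), spread (u (t + 1)) :=
      Finset.sum_le_sum_of_subset_of_nonneg (Finset.range_mono (by omega))
        fun _ _ _ => spread_nonneg _
    have hdouble : ∑ t ∈ Finset.range S, ∑ l ∈ Finset.range N, e (t + 1 + l) ≤
        N * ∑ t ∈ Finset.range (N + S), e (t + 1) := by
      rw [Finset.sum_comm]
      have : ∀ l ∈ Finset.range N, ∑ t ∈ Finset.range S, e (t + 1 + l) ≤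
          ∑ t ∈ Finset.range (N + S), e (t + 1) := by
        intro l hl
        rw [Finset.mem_range] at hl
        have h1 := Finset.sum_range_add (fun t => e (t + 1)) l S
        have h2 : ∑ t ∈ Finset.range (l + S), e (t + 1) ≤
            ∑ t ∈ Finset.range (N + S), e (t + 1) :=
          Finset.sum_le_sum_of_subset_of_nonneg (Finset.range_mono (by omega))
            fun _ _ _ => he _ (by omega)
        have h3 : ∑ t ∈ Finset.range S, e (t + 1 + l) =
            ∑ t ∈ Finset.range S, e (l + t + 1) :=
          Finset.sum_congr rfl fun t _ => by congr 1; omega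
        linarith [hesum l]
      simpa using Finset.sum_le_sum this
    have h1 := hinit N
    have h2 := mul_le_mul_of_nonneg_left hsub (sub_nonneg.2 hε1)
    nlinarith

end Consensus

/-! ### Stepsizes and sums -/

theorem sum_Icc_one_eq_sum_range {M : Type*} [AddCommMonoid M] (f : ℕ → M) (T : ℕ) :
    ∑ t ∈ Finset.Icc 1 T, f t = ∑ t ∈ Finset.range T, f (t + 1) := by
  induction T with
  | zero => simp
  | succ T ih => rw [Finset.sum_Icc_succ_top (by omega), Finset.sum_range_succ, ih]

theorem sum_range_pow_succ_le {μ : ℝ} (h0 : 0 < μ) (h1 : μ < 1) (T : ℕ) :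
    ∑ t ∈ Finset.range T, μ ^ (t + 1) ≤ 1 / (1 - μ) := by
  rw [le_div_iff₀ (sub_pos.2 h1)]
  have h2 := geom_sum_mul_neg μ T
  have h3 : ∑ t ∈ Finset.range T, μ ^ (t + 1) = μ * ∑ t ∈ Finset.range T, μ ^ t := by
    rw [Finset.mul_sum]; exact Finset.sum_congr rfl fun t _ => pow_succ' μ t
  have h4 : 0 < μ ^ T := pow_pos h0 T
  rw [h3]
  nlinarith

theorem le_sum_range_pow_succ {μ : ℝ} (h0 : 0 < μ) (T : ℕ) :
    μ ≤ ∑ t ∈ Finset.range (T + 1), μ ^ (t + 1) := by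
  rw [Finset.sum_range_succ']
  have : 0 ≤ ∑ t ∈ Finset.range T, μ ^ (t + 1 + 1) := Finset.sum_nonneg fun t _ => by positivity
  simpa using this

theorem sum_range_one_div_sqrt_le (T : ℕ) :
    ∑ t ∈ Finset.range T, 1 / √((t + 1 : ℕ) : ℝ) ≤ 2 * √(T : ℝ) := by
  induction T with
  | zero => simp
  | succ T ih =>
    rw [Finset.sum_range_succ]
    have h1 : 0 < √((T + 1 : ℕ) : ℝ) := Real.sqrt_pos.2 (by positivity)
    have h2 : √((T + 1 : ℕ) : ℝ) ^ 2 = T + 1 := by rw [Real.sq_sqrt (by positivity)]; simp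
    have h3 : √(T : ℝ) ^ 2 = T := Real.sq_sqrt (by positivity)
    have h4 : 1 / √((T + 1 : ℕ) : ℝ) ≤ 2 * √((T + 1 : ℕ) : ℝ) - 2 * √(T : ℝ) := by
      rw [div_le_iff₀ h1]
      nlinarith [sq_nonneg (√((T + 1 : ℕ) : ℝ) - √(T : ℝ))]
    linarith

section Stepsize

variable {α₀ μ : ℝ}

theorem stepsize_succ (t : ℕ) : stepsize α₀ μ (t + 1) =
    α₀ * √((∑ k ∈ Finset.range (t + 1), μ ^ (k + 1)) / (t + 1 : ℕ)) := by
  rw [stepsize, sum_Icc_one_eq_sum_range]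

theorem stepsize_pos (hα₀ : 0 < α₀) (h0 : 0 < μ) (t : ℕ) : 0 < stepsize α₀ μ (t + 1) := by
  rw [stepsize_succ]
  exact mul_pos hα₀ (Real.sqrt_pos.2 (div_pos (h0.trans_le (le_sum_range_pow_succ h0 t))
    (by positivity)))

/-- The stepsizes decrease because `Ψ_t / t` is the mean of the decreasing powers of `μ`. -/
theorem stepsize_antitone (hα₀ : 0 < α₀) (h0 : 0 < μ) (h1 : μ < 1) :
    Antitone fun t => stepsize α₀ μ (t + 1) := by
  refine antitone_nat_of_succ_le fun t => ?_
  rw [stepsize_succ, stepsize_succ]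
  refine mul_le_mul_of_nonneg_left (Real.sqrt_le_sqrt ?_) hα₀.le
  rw [div_le_div_iff₀ (by positivity) (by positivity), Finset.sum_range_succ _ (t + 1)]
  have h2 : ((t + 1 : ℕ) : ℝ) * μ ^ (t + 1 + 1) ≤ ∑ k ∈ Finset.range (t + 1), μ ^ (k + 1) := by
    have : ∀ k ∈ Finset.range (t + 1), μ ^ (t + 1 + 1) ≤ μ ^ (k + 1) := fun k hk =>
      pow_le_pow_of_le_one h0.le h1.le (by rw [Finset.mem_range] at hk; omega)
    simpa using Finset.sum_le_sum this
  push_cast at h2 ⊢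
  nlinarith

theorem stepsize_le_div_sqrt (hα₀ : 0 < α₀) (h0 : 0 < μ) (h1 : μ < 1) (t : ℕ) :
    stepsize α₀ μ (t + 1) ≤ α₀ * √(1 / (1 - μ)) * (1 / √((t + 1 : ℕ) : ℝ)) := by
  rw [stepsize_succ, Real.sqrt_div' _ (by positivity), mul_assoc, mul_one_div]
  exact mul_le_mul_of_nonneg_left (div_le_div_of_nonneg_right
    (Real.sqrt_le_sqrt (sum_range_pow_succ_le h0 h1 _)) (Real.sqrt_nonneg _)) hα₀.le

theorem stepsize_le (hα₀ : 0 < α₀) (h0 : 0 < μ) (h1 : μ < 1) (t : ℕ) :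
    stepsize α₀ μ (t + 1) ≤ α₀ * √(1 / (1 - μ)) := by
  refine (stepsize_le_div_sqrt hα₀ h0 h1 t).trans (mul_le_of_le_one_right (by positivity) ?_)
  rw [div_le_one (Real.sqrt_pos.2 (by positivity)), Real.one_le_sqrt]
  exact_mod_cast Nat.succ_pos t

theorem sum_stepsize_le (hα₀ : 0 < α₀) (h0 : 0 < μ) (h1 : μ < 1) (T : ℕ) :
    ∑ t ∈ Finset.range T, stepsize α₀ μ (t + 1) ≤ 2 * (α₀ * √(1 / (1 - μ))) * √(T : ℝ) := by
  refine (Finset.sum_le_sum fun t _ => stepsize_le_div_sqrt hα₀ h0 h1 t).trans ?_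
  rw [← Finset.mul_sum]
  nlinarith [mul_le_mul_of_nonneg_left (sum_range_one_div_sqrt_le T)
    (by positivity : 0 ≤ α₀ * √(1 / (1 - μ)))]

theorem one_div_stepsize_le (hα₀ : 0 < α₀) (h0 : 0 < μ) (t : ℕ) :
    1 / stepsize α₀ μ (t + 1) ≤ 1 / (α₀ * √μ) * √((t + 1 : ℕ) : ℝ) := by
  have h2 : 0 < √((t + 1 : ℕ) : ℝ) := Real.sqrt_pos.2 (by positivity)
  have h3 : 0 < √μ := Real.sqrt_pos.2 h0
  have h4 : α₀ * √μ / √((t + 1 : ℕ) : ℝ) ≤ stepsize α₀ μ (t + 1) := by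
    rw [stepsize_succ, Real.sqrt_div' _ (by positivity), mul_div_assoc]
    exact mul_le_mul_of_nonneg_left (div_le_div_of_nonneg_right
      (Real.sqrt_le_sqrt (le_sum_range_pow_succ h0 t)) h2.le) hα₀.le
  refine (one_div_le_one_div_of_le (by positivity) h4).trans_eq ?_
  field_simp

end Stepsize

/-- Summation by parts for a bounded sequence `Z` against increasing weights `β`. -/
theorem sum_sub_mul_le {Z β : ℕ → ℝ} {M : ℝ} (hβ : Monotone β)
    (hβ0 : ∀ t, 0 ≤ β t) (hZM : ∀ t, Z t ≤ M) (T : ℕ) :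
    ∑ t ∈ Finset.range (T + 1), (Z t - Z (t + 1)) * β t ≤ (M - Z (T + 1)) * β T := by
  induction T with
  | zero =>
    simpa using mul_le_mul_of_nonneg_right (sub_le_sub_right (hZM 0) (Z 1)) (hβ0 0)
  | succ T ih =>
    rw [Finset.sum_range_succ]
    have h1 := hβ (Nat.le_succ T)
    have h2 := hZM (T + 1)
    simp only [Nat.succ_eq_add_one] at h1
    nlinarith

/-! ### One iteration along a trajectory -/

/-- The primal iterates of one run, with the dual variables eliminated: since `α t * γ t = γ₀`,
the constraint part of the update has the constant stepsize `γ₀`. -/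
structure PrimalPath {n p : ℕ} {m : Fin n → ℕ} (Q : Problem n p m) (R G₁ G₂ L w γ₀ : ℝ) (B : ℕ)
    (G : ℕ → Digraph (Fin n)) (W : ℕ → Matrix (Fin n) (Fin n) ℝ) (α : ℕ → ℝ)
    (z zhat x : Fin n → ℕ → E p) : Prop where
  agents_pos : 0 < n
  decisionSet : Q.DecisionSet R
  subgradients : Q.Subgradients G₁ G₂
  lipschitzGrad : Q.LipschitzGrad L
  network : Network G W w B
  weight_pos : 0 < w
  weight_le : w ≤ 1
  penalty_pos : 0 < γ₀
  penalty_le : 4 * G₂ ^ 2 * γ₀ ≤ 1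
  stepsize_pos : ∀ t, 1 ≤ t → 0 < α t
  z_mem : ∀ i t, 1 ≤ t → z i t ∈ Q.X
  zhat_mem : ∀ i t, 1 ≤ t → zhat i t ∈ Q.X
  x_step : ∀ i t, 1 ≤ t → x i t = ∑ j, W t i j • zhat j t
  z_step : ∀ i t, 1 ≤ t → z i (t + 1) = setProj Q.X (x i t - (α t • Q.gradf i t (x i t) +
    γ₀ • (Q.gradg i t (x i t)).adjoint (posVec (Q.g i t (x i t)))))

/-- The constraint violation `‖[g_{i,t}(x_{i,t})]₊‖` of agent `i` for its own constraint. -/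
def violation {n p : ℕ} {m : Fin n → ℕ} (Q : Problem n p m) (x : Fin n → ℕ → E p) (i : Fin n)
    (t : ℕ) : ℝ :=
  ‖posVec (Q.g i t (x i t))‖

/-- The total distance of the broadcast points `ẑ_{i,t}` from the points `z_{i,t}` they encode. -/
def compressionError {n p : ℕ} (z zhat : Fin n → ℕ → E p) (t : ℕ) : ℝ :=
  ∑ i, ‖zhat i t - z i t‖

theorem compressionError_nonneg {n p : ℕ} (z zhat : Fin n → ℕ → E p) (t : ℕ) :
    0 ≤ compressionError z zhat t :=
  Finset.sum_nonneg fun _ _ => norm_nonneg _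

theorem violation_nonneg {n p : ℕ} {m : Fin n → ℕ} (Q : Problem n p m) (x : Fin n → ℕ → E p)
    (i : Fin n) (t : ℕ) : 0 ≤ violation Q x i t :=
  norm_nonneg _

theorem Problem.DecisionSet.norm_sub_le {n p : ℕ} {m : Fin n → ℕ} {Q : Problem n p m} {R : ℝ}
    (h : Q.DecisionSet R) {x y : E p} (hx : x ∈ Q.X) (hy : y ∈ Q.X) : ‖x - y‖ ≤ 2 * R := by
  linarith [_root_.norm_sub_le x y, h.bounded x hx, h.bounded y hy]

/-- The constant in the bound of the total disagreement by the total perturbation. -/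
def consensusConst (n B : ℕ) (w : ℝ) : ℝ := 2 * (n * B : ℕ) / (w ^ (n * B)) ^ 2

theorem consensusConst_nonneg (n B : ℕ) (w : ℝ) : 0 ≤ consensusConst n B w := by
  unfold consensusConst; positivity

namespace PrimalPath

variable {n p : ℕ} {m : Fin n → ℕ} {Q : Problem n p m} {R G₁ G₂ L w γ₀ : ℝ} {B : ℕ}
  {G : ℕ → Digraph (Fin n)} {W : ℕ → Matrix (Fin n) (Fin n) ℝ} {α : ℕ → ℝ}
  {z zhat x : Fin n → ℕ → E p}

theorem x_mem (h : PrimalPath Q R G₁ G₂ L w γ₀ B G W α z zhat x) (i : Fin n) {t : ℕ}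
    (ht : 1 ≤ t) : x i t ∈ Q.X := by
  rw [h.x_step i t ht]
  exact h.decisionSet.convex.sum_mem (fun j _ => h.network.weight_nonneg h.weight_pos ht i j)
    (h.network.row_sum t ht i) fun j _ => h.zhat_mem j t ht

theorem radius_nonneg (h : PrimalPath Q R G₁ G₂ L w γ₀ B G W α z zhat x) : 0 ≤ R :=
  (norm_nonneg _).trans (h.decisionSet.bounded _ (h.z_mem ⟨0, h.agents_pos⟩ 1 le_rfl))

theorem lossBound_nonneg (h : PrimalPath Q R G₁ G₂ L w γ₀ B G W α z zhat x) : 0 ≤ G₁ :=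
  (norm_nonneg _).trans (h.subgradients.bound_f ⟨0, h.agents_pos⟩ 1 le_rfl _
    (h.z_mem ⟨0, h.agents_pos⟩ 1 le_rfl))

theorem constraintBound_nonneg (h : PrimalPath Q R G₁ G₂ L w γ₀ B G W α z zhat x) : 0 ≤ G₂ :=
  (norm_nonneg _).trans (h.subgradients.bound_g ⟨0, h.agents_pos⟩ 1 le_rfl _
    (h.z_mem ⟨0, h.agents_pos⟩ 1 le_rfl))

theorem norm_penalty_le (h : PrimalPath Q R G₁ G₂ L w γ₀ B G W α z zhat x) (i : Fin n) {t : ℕ}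
    (ht : 1 ≤ t) :
    ‖γ₀ • (Q.gradg i t (x i t)).adjoint (posVec (Q.g i t (x i t)))‖ ≤
      γ₀ * (G₂ * violation Q x i t) := by
  rw [norm_smul, Real.norm_of_nonneg h.penalty_pos.le]
  refine mul_le_mul_of_nonneg_left (((Q.gradg i t (x i t)).adjoint.le_opNorm _).trans ?_)
    h.penalty_pos.le
  rw [LinearIsometryEquiv.norm_map]
  exact mul_le_mul_of_nonneg_right (h.subgradients.bound_g i t ht _ (h.x_mem i ht))
    (norm_nonneg _)

theorem norm_gradf_le (h : PrimalPath Q R G₁ G₂ L w γ₀ B G W α z zhat x) (i : Fin n) {t : ℕ}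
    (ht : 1 ≤ t) : ‖α t • Q.gradf i t (x i t)‖ ≤ α t * G₁ := by
  rw [norm_smul, Real.norm_of_nonneg (h.stepsize_pos t ht).le]
  exact mul_le_mul_of_nonneg_left (h.subgradients.bound_f i t ht _ (h.x_mem i ht))
    (h.stepsize_pos t ht).le

/-- The basic inequality for one agent. The constraint part of the update costs at most
`γ₀ ‖[g]₊‖² / 2`, as `4 G₂² γ₀ ≤ 1`, and earns `2 γ₀ (‖[g]₊‖² + c ‖[g]₊‖)` by convexity. -/
theorem norm_z_succ_sub_sq_le (h : PrimalPath Q R G₁ G₂ L w γ₀ B G W α z zhat x) (i : Fin n)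
    {t : ℕ} (ht : 1 ≤ t) {y : E p} (hy : y ∈ Q.X) {c : ℝ} (hc : 0 ≤ c)
    (hyc : ∀ k, Q.g i t y k ≤ -c) :
    ‖z i (t + 1) - y‖ ^ 2 ≤ ‖x i t - y‖ ^ 2 - 2 * α t * ⟪Q.gradf i t (x i t), x i t - y⟫_ℝ +
      2 * α t ^ 2 * G₁ ^ 2 - 3 / 2 * γ₀ * violation Q x i t ^ 2 -
      2 * γ₀ * c * violation Q x i t := by
  have hx := h.x_mem i ht
  have ha := h.norm_gradf_le i ht
  have hb := h.norm_penalty_le i ht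
  have hγ := h.penalty_pos
  set q := posVec (Q.g i t (x i t)) with hq
  set A := Q.gradg i t (x i t) with hA
  set a := α t • Q.gradf i t (x i t) with ha'
  set b := γ₀ • A.adjoint q with hb'
  have hv : violation Q x i t = ‖q‖ := rfl
  rw [hv] at hb ⊢
  have hproj : ‖z i (t + 1) - y‖ ≤ ‖(x i t - y) - (a + b)‖ := by
    rw [h.z_step i t ht]
    refine (norm_setProj_sub_le h.decisionSet.closed h.decisionSet.convex _ hy).trans_eq ?_
    congr 1
    abel
  have hproj2 : ‖z i (t + 1) - y‖ ^ 2 ≤ ‖(x i t - y) - (a + b)‖ ^ 2 :=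
    pow_le_pow_left₀ (norm_nonneg _) hproj 2
  have hin : ‖q‖ ^ 2 + c * ‖q‖ ≤ ⟪q, A (x i t - y)⟫_ℝ := by
    refine sq_add_mul_le_inner_posVec hc fun k => ?_
    have h1 := h.subgradients.subgrad_g i t ht _ hx _ hy k
    rw [← hA, ← neg_sub, map_neg, PiLp.neg_apply] at h1
    linarith [hyc k]
  have hinb : ⟪x i t - y, b⟫_ℝ = γ₀ * ⟪q, A (x i t - y)⟫_ℝ := by
    rw [hb', inner_smul_right, ContinuousLinearMap.adjoint_inner_right, real_inner_comm]
  have hina : ⟪x i t - y, a⟫_ℝ = α t * ⟪Q.gradf i t (x i t), x i t - y⟫_ℝ := by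
    rw [ha', inner_smul_right, real_inner_comm]
  have hsq : ‖a + b‖ ^ 2 ≤ 2 * (α t * G₁) ^ 2 + 1 / 2 * γ₀ * ‖q‖ ^ 2 := by
    have h1 : ‖a + b‖ ^ 2 ≤ (α t * G₁ + γ₀ * (G₂ * ‖q‖)) ^ 2 :=
      pow_le_pow_left₀ (norm_nonneg _) ((norm_add_le a b).trans (add_le_add ha hb)) 2
    have h2 : 4 * G₂ ^ 2 * γ₀ * (γ₀ * ‖q‖ ^ 2) ≤ 1 * (γ₀ * ‖q‖ ^ 2) :=
      mul_le_mul_of_nonneg_right h.penalty_le (by positivity)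
    nlinarith [sq_nonneg (α t * G₁ - γ₀ * (G₂ * ‖q‖))]
  rw [norm_sub_sq_real (x i t - y), inner_add_right, hina, hinb] at hproj2
  have h3 := mul_le_mul_of_nonneg_left hin hγ.le
  nlinarith

/-- Doubly stochastic mixing does not increase the total squared distance to a point. -/
theorem sum_norm_x_sub_sq_le (h : PrimalPath Q R G₁ G₂ L w γ₀ B G W α z zhat x)
    {t : ℕ} (ht : 1 ≤ t) (y : E p) :
    ∑ i, ‖x i t - y‖ ^ 2 ≤ ∑ j, ‖zhat j t - y‖ ^ 2 := by
  have hW := fun i j => h.network.weight_nonneg h.weight_pos ht i j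
  have h1 : ∀ i, ‖x i t - y‖ ^ 2 ≤ ∑ j, W t i j * ‖zhat j t - y‖ ^ 2 := by
    intro i
    have h2 : x i t - y = ∑ j, W t i j • (zhat j t - y) := by
      simp only [smul_sub, Finset.sum_sub_distrib, ← Finset.sum_smul,
        h.network.row_sum t ht i, one_smul, h.x_step i t ht]
    have h3 : ‖x i t - y‖ ≤ ∑ j, W t i j * ‖zhat j t - y‖ := by
      rw [h2]
      refine (norm_sum_le _ _).trans_eq (Finset.sum_congr rfl fun j _ => ?_)
      rw [norm_smul, Real.norm_of_nonneg (hW i j)]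
    exact (pow_le_pow_left₀ (norm_nonneg _) h3 2).trans
      (Real.pow_arith_mean_le_arith_mean_pow _ _ _ (fun j _ => hW i j)
        (h.network.row_sum t ht i) (fun j _ => norm_nonneg _) 2)
  refine (Finset.sum_le_sum fun i _ => h1 i).trans_eq ?_
  rw [Finset.sum_comm]
  refine Finset.sum_congr rfl fun j _ => ?_
  rw [← Finset.sum_mul, h.network.col_sum t ht j, one_mul]

theorem sum_norm_zhat_sub_sq_le (h : PrimalPath Q R G₁ G₂ L w γ₀ B G W α z zhat x)
    {t : ℕ} (ht : 1 ≤ t) {y : E p} (hy : y ∈ Q.X) :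
    ∑ j, ‖zhat j t - y‖ ^ 2 ≤ ∑ j, ‖z j t - y‖ ^ 2 + 4 * R * compressionError z zhat t := by
  rw [compressionError, Finset.mul_sum, ← Finset.sum_add_distrib]
  refine Finset.sum_le_sum fun j _ => ?_
  have h1 := h.decisionSet.norm_sub_le (h.zhat_mem j t ht) hy
  have h2 := h.decisionSet.norm_sub_le (h.z_mem j t ht) hy
  have h3 := norm_sub_le_norm_sub_add_norm_sub (zhat j t) (z j t) y
  have h4 := norm_nonneg (zhat j t - z j t)
  have h5 := norm_nonneg (zhat j t - y)
  have h6 := norm_nonneg (z j t - y)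
  have h7 := h.radius_nonneg
  rcases le_total ‖zhat j t - y‖ ‖z j t - y‖ with hle | hle
  · nlinarith [mul_nonneg h7 h4]
  · nlinarith

/-- The basic inequality for the network. -/
theorem sum_norm_z_succ_sub_sq_le (h : PrimalPath Q R G₁ G₂ L w γ₀ B G W α z zhat x)
    {t : ℕ} (ht : 1 ≤ t) {y : E p} (hy : y ∈ Q.X) {c : ℝ} (hc : 0 ≤ c)
    (hyc : ∀ i k, Q.g i t y k ≤ -c) :
    ∑ i, ‖z i (t + 1) - y‖ ^ 2 ≤ ∑ i, ‖z i t - y‖ ^ 2 + 4 * R * compressionError z zhat t -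
      2 * α t * ∑ i, ⟪Q.gradf i t (x i t), x i t - y⟫_ℝ + 2 * n * α t ^ 2 * G₁ ^ 2 -
      3 / 2 * γ₀ * ∑ i, violation Q x i t ^ 2 - 2 * γ₀ * c * ∑ i, violation Q x i t := by
  have h1 := Finset.sum_le_sum fun i (_ : i ∈ Finset.univ) =>
    h.norm_z_succ_sub_sq_le i ht hy hc (hyc i)
  simp only [Finset.sum_sub_distrib, Finset.sum_add_distrib, ← Finset.mul_sum, Finset.sum_const,
    Finset.card_univ, Fintype.card_fin, nsmul_eq_mul] at h1
  have h2 := h.sum_norm_x_sub_sq_le ht y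
  have h3 := h.sum_norm_zhat_sub_sq_le ht hy
  linarith

theorem norm_x_sub_x_le (h : PrimalPath Q R G₁ G₂ L w γ₀ B G W α z zhat x) {t : ℕ} (ht : 1 ≤ t)
    (i j : Fin n) : ‖x i t - x j t‖ ≤ spread fun i => zhat i t := by
  have hW := fun i j => h.network.weight_nonneg h.weight_pos ht i j
  simpa [h.x_step _ t ht] using norm_average_sub_average_le h.agents_pos le_rfl (hW i) (hW j)
    (h.network.row_sum t ht i) (h.network.row_sum t ht j) (fun i => zhat i t)

theorem sum_spread_zhat_le (h : PrimalPath Q R G₁ G₂ L w γ₀ B G W α z zhat x) (T : ℕ) :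
    ∑ t ∈ Finset.range T, spread (fun i => zhat i (t + 1)) ≤ consensusConst n B w *
      (R + G₁ * ∑ t ∈ Finset.range T, α (t + 1) +
        γ₀ * G₂ * ∑ t ∈ Finset.range T, ∑ i, violation Q x i (t + 1) +
        ∑ t ∈ Finset.range (T + 1), compressionError z zhat (t + 1)) := by
  have hG₁ := h.lossBound_nonneg
  have hG₂ := h.constraintBound_nonneg
  have hγ := h.penalty_pos
  have hstep : ∀ t, 1 ≤ t → ∀ i, ‖zhat i (t + 1) - ∑ j, W t i j • zhat j t‖ ≤
      α t * G₁ + γ₀ * G₂ * ∑ i, violation Q x i t + compressionError z zhat (t + 1) := by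
    intro t ht i
    rw [← h.x_step i t ht]
    have h1 : ‖zhat i (t + 1) - z i (t + 1)‖ ≤ compressionError z zhat (t + 1) :=
      Finset.single_le_sum (f := fun i => ‖zhat i (t + 1) - z i (t + 1)‖)
        (fun _ _ => norm_nonneg _) (Finset.mem_univ i)
    have h2 : violation Q x i t ≤ ∑ i, violation Q x i t :=
      Finset.single_le_sum (f := fun i => violation Q x i t)
        (fun _ _ => violation_nonneg _ _ _ _) (Finset.mem_univ i)
    have h3 : ‖z i (t + 1) - x i t‖ ≤ α t * G₁ + γ₀ * (G₂ * violation Q x i t) := by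
      rw [h.z_step i t ht]
      refine (norm_setProj_sub_le h.decisionSet.closed h.decisionSet.convex _
        (h.x_mem i ht)).trans ?_
      rw [sub_sub_cancel_left, norm_neg]
      exact (norm_add_le _ _).trans (add_le_add (h.norm_gradf_le i ht) (h.norm_penalty_le i ht))
    have h4 := norm_sub_le_norm_sub_add_norm_sub (zhat i (t + 1)) (z i (t + 1)) (x i t)
    have h5 := mul_le_mul_of_nonneg_left h2 (mul_nonneg hγ.le hG₂)
    linarith
  have hspread : ∀ t, 1 ≤ t → spread (fun i => zhat i t) ≤ 2 * R := fun t ht =>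
    spread_le (by linarith [h.radius_nonneg]) fun i j =>
      h.decisionSet.norm_sub_le (h.zhat_mem i t ht) (h.zhat_mem j t ht)
  have key := sum_spread_le h.network h.agents_pos h.weight_pos h.weight_le
    (u := fun t i => zhat i t)
    (fun t ht => add_nonneg (add_nonneg (mul_nonneg (h.stepsize_pos t ht).le hG₁)
      (mul_nonneg (mul_nonneg hγ.le hG₂) (Finset.sum_nonneg fun _ _ => violation_nonneg _ _ _ _)))
      (compressionError_nonneg _ _ _)) hstep hspread T
  have hshift : ∑ t ∈ Finset.range T, compressionError z zhat (t + 1 + 1) ≤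
      ∑ t ∈ Finset.range (T + 1), compressionError z zhat (t + 1) := by
    rw [Finset.sum_range_succ']
    exact le_add_of_nonneg_right (compressionError_nonneg _ _ _)
  simp only [Finset.sum_add_distrib, ← Finset.sum_mul, ← Finset.mul_sum] at key
  have hw2 : 0 < (w ^ (n * B)) ^ 2 := pow_pos (pow_pos h.weight_pos _) _
  rw [consensusConst, div_mul_eq_mul_div, le_div_iff₀ hw2, mul_comm]
  refine key.trans ?_
  have := mul_le_mul_of_nonneg_left hshift (Nat.cast_nonneg (α := ℝ) (n * B))
  linarith

end PrimalPath

/-! ### Regret and constraint violation along a trajectory -/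

/-- The quantitative properties of the stepsizes that the bounds up to iteration `T` use. -/
structure StepsizeBounds (α : ℕ → ℝ) (a c₁ c₂ : ℝ) (T : ℕ) : Prop where
  antitone : Antitone fun t => α (t + 1)
  le : ∀ t, α (t + 1) ≤ a
  sum_le : ∑ t ∈ Finset.range T, α (t + 1) ≤ c₁ * √(T : ℝ)
  inv_le : 1 / α T ≤ c₂ * √(T : ℝ)

/-- The accumulated compression error that enters the bounds up to iteration `T`. It includes
iteration `T + 1`, as the disagreement is perturbed by the next broadcast. -/
def totalError {n p : ℕ} (z zhat : Fin n → ℕ → E p) (T : ℕ) : ℝ :=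
  ∑ t ∈ Finset.range (T + 1), compressionError z zhat (t + 1)

theorem totalError_nonneg {n p : ℕ} (z zhat : Fin n → ℕ → E p) (T : ℕ) :
    0 ≤ totalError z zhat T :=
  Finset.sum_nonneg fun _ _ => compressionError_nonneg _ _ _

theorem Problem.Subgradients.norm_posVec_le {n p : ℕ} {m : Fin n → ℕ} {Q : Problem n p m}
    {G₁ G₂ : ℝ} (h : Q.Subgradients G₁ G₂) (j : Fin n) {t : ℕ} (ht : 1 ≤ t) {x y : E p}
    (hx : x ∈ Q.X) (hy : y ∈ Q.X) :
    ‖posVec (Q.g j t x)‖ ≤ ‖posVec (Q.g j t y)‖ + G₂ * ‖x - y‖ := by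
  have h1 : ∀ k, Q.g j t x k ≤ Q.g j t y k + Q.gradg j t x (x - y) k := fun k => by
    have h2 := h.subgrad_g j t ht _ hx _ hy k
    rw [← neg_sub, map_neg, PiLp.neg_apply] at h2
    linarith
  refine (norm_posVec_le_of_le_add h1).trans (add_le_add le_rfl ?_)
  exact (ContinuousLinearMap.le_opNorm _ _).trans
    (mul_le_mul_of_nonneg_right (h.bound_g j t ht _ hx) (norm_nonneg _))

namespace PrimalPath

variable {n p : ℕ} {m : Fin n → ℕ} {Q : Problem n p m} {R G₁ G₂ L w γ₀ : ℝ} {B : ℕ}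
  {G : ℕ → Digraph (Fin n)} {W : ℕ → Matrix (Fin n) (Fin n) ℝ} {α : ℕ → ℝ}
  {z zhat x : Fin n → ℕ → E p} {a c₁ c₂ : ℝ}

theorem sum_norm_z_sub_sq_le (h : PrimalPath Q R G₁ G₂ L w γ₀ B G W α z zhat x) {t : ℕ}
    (ht : 1 ≤ t) {y : E p} (hy : y ∈ Q.X) : ∑ i, ‖z i t - y‖ ^ 2 ≤ 4 * n * R ^ 2 := by
  have h1 : ∀ i ∈ Finset.univ, ‖z i t - y‖ ^ 2 ≤ (2 * R) ^ 2 := fun i _ =>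
    pow_le_pow_left₀ (norm_nonneg _) (h.decisionSet.norm_sub_le (h.z_mem i t ht) hy) 2
  have h2 := Finset.sum_le_sum h1
  simp only [Finset.sum_const, Finset.card_univ, Fintype.card_fin, nsmul_eq_mul] at h2
  linarith

/-- The regret of the agents with respect to their own losses. Dividing the basic inequality by
the stepsize keeps the squared violations, with weights `1 / α`, on the left. -/
theorem sum_inner_gradf_le (h : PrimalPath Q R G₁ G₂ L w γ₀ B G W α z zhat x)
    (hanti : Antitone fun t => α (t + 1)) (T : ℕ) {y : E p} (hy : y ∈ Q.feasible (T + 1)) :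
    ∑ t ∈ Finset.range (T + 1), ∑ i,
        ⟪Q.gradf i (t + 1) (x i (t + 1)), x i (t + 1) - y⟫_ℝ +
      3 / 4 * γ₀ * ∑ t ∈ Finset.range (T + 1),
        (∑ i, violation Q x i (t + 1) ^ 2) / α (t + 1) ≤
      (2 * n * R ^ 2 + 2 * R * totalError z zhat (T + 1)) * (1 / α (T + 1)) +
        n * G₁ ^ 2 * ∑ t ∈ Finset.range (T + 1), α (t + 1) := by
  have hR := h.radius_nonneg
  set β : ℕ → ℝ := fun t => 1 / α (t + 1) with hβ
  have hβ0 : ∀ t, 0 < β t := fun t => one_div_pos.2 (h.stepsize_pos _ (by omega))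
  have hβm : Monotone β := fun s t hst =>
    one_div_le_one_div_of_le (h.stepsize_pos _ (by omega)) (hanti hst)
  set Z : ℕ → ℝ := fun t => ∑ i, ‖z i (t + 1) - y‖ ^ 2 with hZ
  set D := compressionError z zhat with hD
  have hD0 : ∀ t, 0 ≤ D t := compressionError_nonneg z zhat
  have hstep : ∀ t ∈ Finset.range (T + 1),
      ∑ i, ⟪Q.gradf i (t + 1) (x i (t + 1)), x i (t + 1) - y⟫_ℝ +
        3 / 4 * γ₀ * ((∑ i, violation Q x i (t + 1) ^ 2) / α (t + 1)) ≤
      1 / 2 * ((Z t - Z (t + 1)) * β t) + 2 * R * (D (t + 1) * β T) +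
        n * G₁ ^ 2 * α (t + 1) := by
    intro t ht
    rw [Finset.mem_range] at ht
    have h1 := h.sum_norm_z_succ_sub_sq_le (t := t + 1) (by omega) hy.1 le_rfl
      fun i k => by
        simpa [Problem.globalConstraint] using hy.2 (t + 1) (by omega) (by omega) ⟨i, k⟩
    have hα := h.stepsize_pos (t + 1) (by omega)
    have h2 : D (t + 1) * β t ≤ D (t + 1) * β T :=
      mul_le_mul_of_nonneg_left (hβm (by omega)) (hD0 _)
    have h3 := mul_le_mul_of_nonneg_left h2 hR
    have h4 := mul_le_mul_of_nonneg_right h1 (hβ0 t).le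
    have h5 : α (t + 1) * β t = 1 := mul_one_div_cancel hα.ne'
    rw [div_eq_mul_one_div (∑ i, violation Q x i (t + 1) ^ 2)]
    change Z (t + 1) * β t ≤ (Z t + 4 * R * D (t + 1) - _ + _ - _ - _) * β t at h4
    change _ + 3 / 4 * γ₀ * (_ * β t) ≤ _
    set F := ∑ i, ⟪Q.gradf i (t + 1) (x i (t + 1)), x i (t + 1) - y⟫_ℝ
    set S := ∑ i, violation Q x i (t + 1) ^ 2
    have h6 : (Z t + 4 * R * D (t + 1) - 2 * α (t + 1) * F +
        2 * n * α (t + 1) ^ 2 * G₁ ^ 2 - 3 / 2 * γ₀ * S - 2 * γ₀ * 0 *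
          ∑ i, violation Q x i (t + 1)) * β t =
        Z t * β t + 4 * (R * (D (t + 1) * β t)) - 2 * F * (α (t + 1) * β t) +
        2 * n * α (t + 1) * G₁ ^ 2 * (α (t + 1) * β t) - 3 / 2 * γ₀ * (S * β t) := by ring
    rw [h6, h5] at h4
    linarith
  have hsum := Finset.sum_le_sum hstep
  simp only [Finset.sum_add_distrib, ← Finset.mul_sum, ← Finset.sum_mul] at hsum
  have hparts := sum_sub_mul_le hβm (fun t => (hβ0 t).le)
    (fun t => h.sum_norm_z_sub_sq_le (t := t + 1) (by omega) hy.1) T (Z := Z)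
  have hZT : 0 ≤ Z (T + 1) * β T :=
    mul_nonneg (Finset.sum_nonneg fun i _ => sq_nonneg _) (hβ0 T).le
  have htot : ∑ t ∈ Finset.range (T + 1), D (t + 1) ≤ totalError z zhat (T + 1) := by
    rw [totalError, Finset.sum_range_succ _ (T + 1)]
    exact le_add_of_nonneg_right (hD0 _)
  have h7 := mul_le_mul_of_nonneg_left (mul_le_mul_of_nonneg_right htot (hβ0 T).le) hR
  change _ ≤ _ * β T + _
  linarith

/-- Without dividing by the stepsize, the basic inequality bounds the squared violations and, at
a point with slack `c`, also the violations themselves. -/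
theorem sum_violation_sq_le (h : PrimalPath Q R G₁ G₂ L w γ₀ B G W α z zhat x)
    (ha : ∀ t, α (t + 1) ≤ a) (T : ℕ) {y : E p} (hy : y ∈ Q.X) {c : ℝ} (hc : 0 ≤ c)
    (hyc : ∀ t, 1 ≤ t → t ≤ T → ∀ k, Q.globalConstraint t y k ≤ -c) :
    3 / 2 * γ₀ * ∑ t ∈ Finset.range T, ∑ i, violation Q x i (t + 1) ^ 2 +
      2 * γ₀ * c * ∑ t ∈ Finset.range T, ∑ i, violation Q x i (t + 1) ≤
      4 * n * R ^ 2 + 4 * R * totalError z zhat T +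
        (4 * n * R * G₁ + 2 * n * G₁ ^ 2 * a) * ∑ t ∈ Finset.range T, α (t + 1) := by
  have hR := h.radius_nonneg
  have hG₁ := h.lossBound_nonneg
  set Z : ℕ → ℝ := fun t => ∑ i, ‖z i (t + 1) - y‖ ^ 2 with hZ
  set D := compressionError z zhat with hD
  have hstep : ∀ t ∈ Finset.range T,
      3 / 2 * γ₀ * ∑ i, violation Q x i (t + 1) ^ 2 +
        2 * γ₀ * c * ∑ i, violation Q x i (t + 1) ≤
      (Z t - Z (t + 1)) + 4 * R * D (t + 1) +
        (4 * n * R * G₁ + 2 * n * G₁ ^ 2 * a) * α (t + 1) := by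
    intro t ht
    rw [Finset.mem_range] at ht
    have h1 := h.sum_norm_z_succ_sub_sq_le (t := t + 1) (by omega) hy hc
      fun i k => by
        simpa [Problem.globalConstraint] using hyc (t + 1) (by omega) (by omega) ⟨i, k⟩
    have hα := h.stepsize_pos (t + 1) (by omega)
    have h2 : -(n * (G₁ * (2 * R))) ≤
        ∑ i, ⟪Q.gradf i (t + 1) (x i (t + 1)), x i (t + 1) - y⟫_ℝ := by
      have h3 : ∀ i ∈ Finset.univ, -(G₁ * (2 * R)) ≤
          ⟪Q.gradf i (t + 1) (x i (t + 1)), x i (t + 1) - y⟫_ℝ := fun i _ => by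
        have hx := h.x_mem i (t := t + 1) (by omega)
        refine neg_le_of_abs_le ((abs_real_inner_le_norm _ _).trans ?_)
        exact mul_le_mul (h.subgradients.bound_f i (t + 1) (by omega) _ hx)
          (h.decisionSet.norm_sub_le hx hy) (norm_nonneg _) hG₁
      simpa using Finset.sum_le_sum h3
    have h4 := mul_le_mul_of_nonneg_left h2 hα.le
    have h5 : n * α (t + 1) ^ 2 * G₁ ^ 2 ≤ n * (a * α (t + 1)) * G₁ ^ 2 := by
      refine mul_le_mul_of_nonneg_right (mul_le_mul_of_nonneg_left ?_ (Nat.cast_nonneg n))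
        (sq_nonneg G₁)
      rw [sq]
      exact mul_le_mul_of_nonneg_right (ha t) hα.le
    change Z (t + 1) ≤ Z t + 4 * R * D (t + 1) - _ + _ - _ - _ at h1
    linarith
  have hsum := Finset.sum_le_sum hstep
  simp only [Finset.sum_add_distrib, ← Finset.mul_sum, Finset.sum_range_sub'] at hsum
  have hZ0 : Z 0 ≤ 4 * n * R ^ 2 := h.sum_norm_z_sub_sq_le le_rfl hy
  have hZT : 0 ≤ Z T := Finset.sum_nonneg fun i _ => sq_nonneg _
  have htot : ∑ t ∈ Finset.range T, D (t + 1) ≤ totalError z zhat T := by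
    rw [totalError, Finset.sum_range_succ _ T]
    exact le_add_of_nonneg_right (compressionError_nonneg _ _ _)
  have h7 := mul_le_mul_of_nonneg_left htot hR
  linarith

/-- Replacing the decisions of all agents by that of agent `i` costs at most a multiple of the
disagreement. -/
theorem inner_globalGrad_le (h : PrimalPath Q R G₁ G₂ L w γ₀ B G W α z zhat x) (i : Fin n)
    {t : ℕ} (ht : 1 ≤ t) {y : E p} (hy : y ∈ Q.X) :
    ⟪Q.globalGrad t (x i t), x i t - y⟫_ℝ ≤
      1 / (n : ℝ) * ∑ j, ⟪Q.gradf j t (x j t), x j t - y⟫_ℝ +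
        (2 * R * |L| + G₁) * spread fun i => zhat i t := by
  have hn : (0 : ℝ) < n := Nat.cast_pos.2 h.agents_pos
  set Δ := spread fun i => zhat i t with hΔ
  have hΔ0 : 0 ≤ Δ := spread_nonneg _
  have h1 : ∀ j ∈ Finset.univ, ⟪Q.gradf j t (x i t), x i t - y⟫_ℝ ≤
      ⟪Q.gradf j t (x j t), x j t - y⟫_ℝ + (2 * R * |L| + G₁) * Δ := by
    intro j _
    have hxi := h.x_mem i ht
    have hxj := h.x_mem j ht
    have hij := h.norm_x_sub_x_le ht i j
    have e1 : ⟪Q.gradf j t (x i t), x i t - y⟫_ℝ = ⟪Q.gradf j t (x j t), x j t - y⟫_ℝ +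
        (⟪Q.gradf j t (x i t) - Q.gradf j t (x j t), x i t - y⟫_ℝ +
          ⟪Q.gradf j t (x j t), x i t - x j t⟫_ℝ) := by
      simp only [inner_sub_left, inner_sub_right]; ring
    have e2 : ⟪Q.gradf j t (x i t) - Q.gradf j t (x j t), x i t - y⟫_ℝ ≤
        (|L| * Δ) * (2 * R) := by
      refine (real_inner_le_norm _ _).trans (mul_le_mul ?_ (h.decisionSet.norm_sub_le hxi hy)
        (norm_nonneg _) (mul_nonneg (abs_nonneg L) hΔ0))
      exact (h.lipschitzGrad j t ht _ hxi _ hxj).trans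
        (mul_le_mul (le_abs_self L) hij (norm_nonneg _) (abs_nonneg L))
    have e3 : ⟪Q.gradf j t (x j t), x i t - x j t⟫_ℝ ≤ G₁ * Δ :=
      (real_inner_le_norm _ _).trans (mul_le_mul (h.subgradients.bound_f j t ht _ hxj) hij
        (norm_nonneg _) h.lossBound_nonneg)
    rw [e1]
    linarith
  have h2 := Finset.sum_le_sum h1
  rw [Problem.globalGrad, real_inner_smul_left, sum_inner]
  simp only [Finset.sum_add_distrib, Finset.sum_const, Finset.card_univ, Fintype.card_fin,
    nsmul_eq_mul] at h2
  refine (mul_le_mul_of_nonneg_left h2 (one_div_nonneg.2 hn.le)).trans_eq ?_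
  field_simp

theorem netReg_le_of_forall (hn : 0 < n) {T : ℕ} (hne : (Q.feasible T).Nonempty) {b : ℝ}
    (hb : ∀ i, ∀ y ∈ Q.feasible T, ∑ t ∈ Finset.range T,
      ⟪Q.globalGrad (t + 1) (x i (t + 1)), x i (t + 1) - y⟫_ℝ ≤ b) : Q.netReg x T ≤ b := by
  have : Nonempty (Q.feasible T) := hne.to_subtype
  have hn' : (0 : ℝ) < n := Nat.cast_pos.2 hn
  have h1 : ∀ i ∈ Finset.univ, ((∑ t ∈ Finset.Icc 1 T, ⟪Q.globalGrad t (x i t), x i t⟫_ℝ) -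
      ⨅ y : Q.feasible T, ⟪∑ t ∈ Finset.Icc 1 T, Q.globalGrad t (x i t), (y : E p)⟫_ℝ) ≤ b := by
    intro i _
    rw [sub_le_comm]
    refine le_ciInf fun y => ?_
    have h2 := hb i y y.2
    simp only [inner_sub_right, Finset.sum_sub_distrib] at h2
    rw [sum_inner, sum_Icc_one_eq_sum_range, sum_Icc_one_eq_sum_range]
    linarith
  have h3 := Finset.sum_le_sum h1
  simp only [Finset.sum_const, Finset.card_univ, Fintype.card_fin, nsmul_eq_mul] at h3
  rw [Problem.netReg, one_div_mul_eq_div, div_le_iff₀ hn', mul_comm b]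
  exact h3

theorem one_le_sqrt_natCast {T : ℕ} (hT : 1 ≤ T) : 1 ≤ √(T : ℝ) := by
  rw [Real.one_le_sqrt]; exact_mod_cast hT

theorem sq_sum_violation_le (Q : Problem n p m) (x : Fin n → ℕ → E p) (t : ℕ) :
    (∑ i, violation Q x i t) ^ 2 ≤ n * ∑ i, violation Q x i t ^ 2 := by
  simpa using sq_sum_le_card_mul_sum_sq (s := Finset.univ) (f := fun i => violation Q x i t)

/-- The violations that enter through the disagreement are absorbed by the weighted squared
violations which the regret estimate leaves over. -/
theorem netReg_le (h : PrimalPath Q R G₁ G₂ L w γ₀ B G W α z zhat x) {T : ℕ} (hT : 1 ≤ T)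
    (hα : StepsizeBounds α a c₁ c₂ T) (hne : (Q.feasible T).Nonempty) :
    Q.netReg x T ≤
      ((2 * R ^ 2 * c₂ + G₁ ^ 2 * c₁ +
          (2 * R * |L| + G₁) * consensusConst n B w * (R + G₁ * c₁) +
          ((2 * R * |L| + G₁) * consensusConst n B w * (γ₀ * G₂)) ^ 2 * n ^ 2 / (3 * γ₀) * c₁) +
        (2 * R * c₂ / n + (2 * R * |L| + G₁) * consensusConst n B w) * totalError z zhat T) *
      √(T : ℝ) := by
  have hR := h.radius_nonneg
  have hG₁ := h.lossBound_nonneg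
  have hG₂ := h.constraintBound_nonneg
  have hγ := h.penalty_pos
  have hn : (0 : ℝ) < n := Nat.cast_pos.2 h.agents_pos
  have hΛ := consensusConst_nonneg n B w
  have hD := totalError_nonneg z zhat T
  have hr := one_le_sqrt_natCast hT
  refine netReg_le_of_forall h.agents_pos hne fun i y hy => ?_
  set r := √(T : ℝ) with hr'
  set D := totalError z zhat T with hD'
  set Λ := consensusConst n B w with hΛ'
  set M := 2 * R * |L| + G₁ with hM
  have hM0 : 0 ≤ M := by positivity
  set κ := M * Λ * (γ₀ * G₂) with hκ
  have h1 : ∑ t ∈ Finset.range T, ⟪Q.globalGrad (t + 1) (x i (t + 1)), x i (t + 1) - y⟫_ℝ ≤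
      1 / (n : ℝ) * ∑ t ∈ Finset.range T, ∑ j,
          ⟪Q.gradf j (t + 1) (x j (t + 1)), x j (t + 1) - y⟫_ℝ +
        M * ∑ t ∈ Finset.range T, spread fun i => zhat i (t + 1) := by
    rw [Finset.mul_sum, Finset.mul_sum, ← Finset.sum_add_distrib]
    exact Finset.sum_le_sum fun t _ => h.inner_globalGrad_le i (by omega) hy.1
  have h2 : ∑ t ∈ Finset.range T, ∑ j, ⟪Q.gradf j (t + 1) (x j (t + 1)), x j (t + 1) - y⟫_ℝ +
      3 / 4 * γ₀ * ∑ t ∈ Finset.range T, (∑ i, violation Q x i (t + 1) ^ 2) / α (t + 1) ≤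
      (2 * n * R ^ 2 + 2 * R * D) * (1 / α T) +
        n * G₁ ^ 2 * ∑ t ∈ Finset.range T, α (t + 1) := by
    obtain ⟨S, rfl⟩ := Nat.exists_eq_add_of_le' hT
    exact h.sum_inner_gradf_le hα.antitone S hy
  have h3 := h.sum_spread_zhat_le T
  have h4 : κ * ∑ t ∈ Finset.range T, ∑ i, violation Q x i (t + 1) ≤
      3 * γ₀ / (4 * n) *
          ∑ t ∈ Finset.range T, (∑ i, violation Q x i (t + 1) ^ 2) / α (t + 1) +
        κ ^ 2 * n ^ 2 / (3 * γ₀) * ∑ t ∈ Finset.range T, α (t + 1) := by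
    rw [Finset.mul_sum, Finset.mul_sum, Finset.mul_sum, ← Finset.sum_add_distrib]
    refine Finset.sum_le_sum fun t _ => ?_
    have hαt := h.stepsize_pos (t + 1) (by omega)
    have h5 := sq_sum_violation_le Q x (t + 1)
    set A := ∑ i, violation Q x i (t + 1)
    set S := ∑ i, violation Q x i (t + 1) ^ 2
    have h6 : 3 * γ₀ / (4 * n ^ 2) * (A ^ 2 / α (t + 1)) ≤
        3 * γ₀ / (4 * n) * (S / α (t + 1)) := by
      calc _ ≤ 3 * γ₀ / (4 * n ^ 2) * ((n * S) / α (t + 1)) := by gcongr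
        _ = _ := by field_simp
    refine le_trans ?_ (add_le_add h6 le_rfl)
    -- Young's inequality `κ A ≤ (3 γ₀ / 4 n²) A² / α + κ² n² α / (3 γ₀)`, as a complete square
    have h7 : 3 * γ₀ / (4 * n ^ 2) * (A ^ 2 / α (t + 1)) +
        κ ^ 2 * n ^ 2 / (3 * γ₀) * α (t + 1) - κ * A =
        (3 * γ₀ * A - 2 * n ^ 2 * κ * α (t + 1)) ^ 2 / (12 * γ₀ * n ^ 2 * α (t + 1)) := by
      field_simp; ring
    have h8 : 0 ≤ (3 * γ₀ * A - 2 * n ^ 2 * κ * α (t + 1)) ^ 2 /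
        (12 * γ₀ * n ^ 2 * α (t + 1)) := by positivity
    linarith
  set Sα := ∑ t ∈ Finset.range T, α (t + 1) with hSα
  set SA := ∑ t ∈ Finset.range T, ∑ i, violation Q x i (t + 1) with hSA
  set Sβ := ∑ t ∈ Finset.range T, (∑ i, violation Q x i (t + 1) ^ 2) / α (t + 1) with hSβ
  set F := ∑ t ∈ Finset.range T, ∑ j, ⟪Q.gradf j (t + 1) (x j (t + 1)), x j (t + 1) - y⟫_ℝ
  change _ ≤ Λ * (R + G₁ * Sα + γ₀ * G₂ * SA + D) at h3
  have h9 : 1 / (n : ℝ) * F ≤ (2 * R ^ 2 + 2 * R * D / n) * (c₂ * r) + G₁ ^ 2 * Sα -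
      3 * γ₀ / (4 * n) * Sβ := by
    have h10 : (2 * n * R ^ 2 + 2 * R * D) * (1 / α T) ≤
        (2 * n * R ^ 2 + 2 * R * D) * (c₂ * r) :=
      mul_le_mul_of_nonneg_left hα.inv_le (by positivity)
    have h11 : 1 / (n : ℝ) * F ≤ 1 / (n : ℝ) * ((2 * n * R ^ 2 + 2 * R * D) * (c₂ * r) +
        n * G₁ ^ 2 * Sα - 3 / 4 * γ₀ * Sβ) :=
      mul_le_mul_of_nonneg_left (by linarith) (by positivity)
    refine h11.trans_eq ?_
    field_simp
  have h12 := mul_le_mul_of_nonneg_left h3 hM0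
  have h13 : (G₁ ^ 2 + M * Λ * G₁ + κ ^ 2 * n ^ 2 / (3 * γ₀)) * Sα ≤
      (G₁ ^ 2 + M * Λ * G₁ + κ ^ 2 * n ^ 2 / (3 * γ₀)) * (c₁ * r) :=
    mul_le_mul_of_nonneg_left hα.sum_le (by positivity)
  have h14 : M * Λ * (R + D) * 1 ≤ M * Λ * (R + D) * r :=
    mul_le_mul_of_nonneg_left hr (by positivity)
  have h15 : M * (Λ * (R + G₁ * Sα + γ₀ * G₂ * SA + D)) =
      M * Λ * (R + D) * 1 + M * Λ * G₁ * Sα + κ * SA := by rw [hκ]; ring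
  have h16 : ((2 * R ^ 2 * c₂ + G₁ ^ 2 * c₁ + M * Λ * (R + G₁ * c₁) +
      κ ^ 2 * n ^ 2 / (3 * γ₀) * c₁) + (2 * R * c₂ / n + M * Λ) * D) * r =
      (2 * R ^ 2 + 2 * R * D / n) * (c₂ * r) +
      (G₁ ^ 2 + M * Λ * G₁ + κ ^ 2 * n ^ 2 / (3 * γ₀)) * (c₁ * r) + M * Λ * (R + D) * r := by
    ring
  rw [h16]
  linarith

/-- Agent `i` violates the constraint of agent `j` at most as much as agent `j` does, up to the
disagreement. -/
theorem norm_posVec_le (h : PrimalPath Q R G₁ G₂ L w γ₀ B G W α z zhat x) (i j : Fin n)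
    {t : ℕ} (ht : 1 ≤ t) :
    ‖posVec (Q.g j t (x i t))‖ ≤ violation Q x j t + G₂ * spread fun i => zhat i t :=
  (h.subgradients.norm_posVec_le j ht (h.x_mem i ht) (h.x_mem j ht)).trans
    (add_le_add le_rfl (mul_le_mul_of_nonneg_left (h.norm_x_sub_x_le ht i j)
      h.constraintBound_nonneg))

theorem netCCV_le_sum_violation (h : PrimalPath Q R G₁ G₂ L w γ₀ B G W α z zhat x) {T : ℕ}
    (hT : 1 ≤ T) (hα : StepsizeBounds α a c₁ c₂ T) :
    Q.netCCV x T ≤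
      (1 + n * G₂ * consensusConst n B w * (γ₀ * G₂)) *
        ∑ t ∈ Finset.range T, ∑ i, violation Q x i (t + 1) +
      n * G₂ * consensusConst n B w * (R + G₁ * c₁ + totalError z zhat T) * √(T : ℝ) := by
  have hR := h.radius_nonneg
  have hG₁ := h.lossBound_nonneg
  have hG₂ := h.constraintBound_nonneg
  have hγ := h.penalty_pos
  have hn : (0 : ℝ) < n := Nat.cast_pos.2 h.agents_pos
  have hΛ := consensusConst_nonneg n B w
  have hD := totalError_nonneg z zhat T
  have hr := one_le_sqrt_natCast hT
  have h1 : Q.netCCV x T ≤ ∑ t ∈ Finset.range T, ∑ i, violation Q x i (t + 1) +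
      n * G₂ * ∑ t ∈ Finset.range T, spread fun i => zhat i (t + 1) := by
    rw [Problem.netCCV, one_div_mul_eq_div, div_le_iff₀ hn]
    have h2 : ∀ i ∈ Finset.univ, ∑ t ∈ Finset.Icc 1 T,
        ‖posVec (Q.globalConstraint t (x i t))‖ ≤
        ∑ t ∈ Finset.range T, ∑ i, violation Q x i (t + 1) +
          n * G₂ * ∑ t ∈ Finset.range T, spread fun i => zhat i (t + 1) := by
      intro i _
      rw [sum_Icc_one_eq_sum_range, Finset.mul_sum, ← Finset.sum_add_distrib]
      refine Finset.sum_le_sum fun t _ => (norm_posVec_globalConstraint_le _ _ _).trans ?_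
      refine (Finset.sum_le_sum fun j _ => h.norm_posVec_le i j (by omega)).trans_eq ?_
      simp only [Finset.sum_add_distrib, Finset.sum_const, Finset.card_univ, Fintype.card_fin,
        nsmul_eq_mul, mul_assoc]
    refine (Finset.sum_le_sum h2).trans_eq ?_
    rw [Finset.sum_const, Finset.card_univ, Fintype.card_fin, nsmul_eq_mul, mul_comm]
  have h3 := h.sum_spread_zhat_le T
  set r := √(T : ℝ) with hr'
  set D := totalError z zhat T with hD'
  set Λ := consensusConst n B w with hΛ'
  set Sα := ∑ t ∈ Finset.range T, α (t + 1) with hSα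
  set SA := ∑ t ∈ Finset.range T, ∑ i, violation Q x i (t + 1) with hSA
  change _ ≤ Λ * (R + G₁ * Sα + γ₀ * G₂ * SA + D) at h3
  have h4 := mul_le_mul_of_nonneg_left h3 (mul_nonneg hn.le hG₂)
  have h5 : n * G₂ * Λ * G₁ * Sα ≤ n * G₂ * Λ * G₁ * (c₁ * r) :=
    mul_le_mul_of_nonneg_left hα.sum_le (by positivity)
  have h6 : n * G₂ * Λ * (R + D) * 1 ≤ n * G₂ * Λ * (R + D) * r :=
    mul_le_mul_of_nonneg_left hr (by positivity)
  linarith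

/-- The right-hand side of `sum_violation_sq_le` is of order `√T`. -/
theorem budget_le (h : PrimalPath Q R G₁ G₂ L w γ₀ B G W α z zhat x) {T : ℕ} (hT : 1 ≤ T)
    (hα : StepsizeBounds α a c₁ c₂ T) :
    4 * n * R ^ 2 + 4 * R * totalError z zhat T +
        (4 * n * R * G₁ + 2 * n * G₁ ^ 2 * a) * ∑ t ∈ Finset.range T, α (t + 1) ≤
      (4 * n * R ^ 2 + (4 * n * R * G₁ + 2 * n * G₁ ^ 2 * a) * c₁ +
        4 * R * totalError z zhat T) * √(T : ℝ) := by
  have hR := h.radius_nonneg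
  have hG₁ := h.lossBound_nonneg
  have hD := totalError_nonneg z zhat T
  have ha : 0 ≤ a := (h.stepsize_pos 1 le_rfl).le.trans (hα.le 0)
  have h1 := mul_le_mul_of_nonneg_left hα.sum_le
    (by positivity : 0 ≤ 4 * n * R * G₁ + 2 * n * G₁ ^ 2 * a)
  have h2 := mul_le_mul_of_nonneg_left (one_le_sqrt_natCast hT)
    (by positivity : 0 ≤ 4 * n * R ^ 2 + 4 * R * totalError z zhat T)
  linarith

/-- At a Slater point the violations themselves, not only their squares, sum up to `O(√T)`. -/
theorem sum_violation_le_of_slater (h : PrimalPath Q R G₁ G₂ L w γ₀ B G W α z zhat x) {T : ℕ}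
    (hT : 1 ≤ T) (hα : StepsizeBounds α a c₁ c₂ T) {c : ℝ} (hc : 0 < c) (hQ : Q.Slater c) :
    ∑ t ∈ Finset.range T, ∑ i, violation Q x i (t + 1) ≤
      1 / (2 * γ₀ * c) * ((4 * n * R ^ 2 + (4 * n * R * G₁ + 2 * n * G₁ ^ 2 * a) * c₁ +
        4 * R * totalError z zhat T) * √(T : ℝ)) := by
  obtain ⟨y, hy, hyc⟩ := hQ
  have hγ := h.penalty_pos
  have h1 := h.sum_violation_sq_le hα.le T hy hc.le fun t ht _ => hyc t ht
  have h2 := h.budget_le hT hα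
  have h3 : 0 ≤ 3 / 2 * γ₀ * ∑ t ∈ Finset.range T, ∑ i, violation Q x i (t + 1) ^ 2 :=
    mul_nonneg (by positivity)
      (Finset.sum_nonneg fun _ _ => Finset.sum_nonneg fun _ _ => sq_nonneg _)
  rw [one_div_mul_eq_div, le_div_iff₀ (by positivity)]
  linarith

theorem sum_violation_le (h : PrimalPath Q R G₁ G₂ L w γ₀ B G W α z zhat x) {T : ℕ}
    (hT : 1 ≤ T) (hα : StepsizeBounds α a c₁ c₂ T) (hne : (Q.feasible T).Nonempty) :
    ∑ t ∈ Finset.range T, ∑ i, violation Q x i (t + 1) ≤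
      (1 / 2 + n / (3 * γ₀) * (4 * n * R ^ 2 + (4 * n * R * G₁ + 2 * n * G₁ ^ 2 * a) * c₁ +
        4 * R * totalError z zhat T)) * (T : ℝ) ^ (3 / 4 : ℝ) := by
  obtain ⟨y, hy, hyc⟩ := hne
  have hγ := h.penalty_pos
  have h1 := h.sum_violation_sq_le hα.le T hy le_rfl fun t ht htT k => by
    simpa using hyc t ht htT k
  have h2 := h.budget_le hT hα
  have hT0 : (0 : ℝ) < T := by exact_mod_cast hT
  set b := 4 * n * R ^ 2 + (4 * n * R * G₁ + 2 * n * G₁ ^ 2 * a) * c₁ +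
        4 * R * totalError z zhat T
  set SS := ∑ t ∈ Finset.range T, ∑ i, violation Q x i (t + 1) ^ 2
  -- `A ≤ (l A² + 1 / l) / 2` with `l = T ^ (1 / 4)` balances the two contributions
  set l := (T : ℝ) ^ (1 / 4 : ℝ) with hl
  have hl0 : 0 < l := Real.rpow_pos_of_pos hT0 _
  have h3 : √(T : ℝ) * l = (T : ℝ) ^ (3 / 4 : ℝ) := by
    rw [hl, Real.sqrt_eq_rpow, ← Real.rpow_add hT0]; norm_num
  have h4 : (T : ℝ) = l * (T : ℝ) ^ (3 / 4 : ℝ) := by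
    rw [hl, ← Real.rpow_add hT0]; norm_num
  have h5 : ∀ t ∈ Finset.range T, ∑ i, violation Q x i (t + 1) ≤
      1 / 2 * (l * n * ∑ i, violation Q x i (t + 1) ^ 2) + 1 / 2 * (1 / l) := by
    intro t _
    have h6 := mul_le_mul_of_nonneg_left (sq_sum_violation_le Q x (t + 1)) hl0.le
    set A := ∑ i, violation Q x i (t + 1)
    have h7 : l * A ^ 2 + 1 / l - 2 * A = (l * A - 1) ^ 2 / l := by field_simp; ring
    have h8 : 0 ≤ (l * A - 1) ^ 2 / l := by positivity
    linarith
  have h9 := Finset.sum_le_sum h5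
  rw [Finset.sum_add_distrib, ← Finset.mul_sum, ← Finset.mul_sum, Finset.sum_const,
    Finset.card_range, nsmul_eq_mul] at h9
  have h10 : SS ≤ 2 / (3 * γ₀) * (b * √(T : ℝ)) := by
    rw [div_mul_eq_mul_div, le_div_iff₀ (by positivity)]
    linarith
  have h11 : l * n * SS ≤ l * n * (2 / (3 * γ₀) * (b * √(T : ℝ))) :=
    mul_le_mul_of_nonneg_left h10 (by positivity)
  have h12 : l * n * (2 / (3 * γ₀) * (b * √(T : ℝ))) =
      2 * (n / (3 * γ₀) * b * (T : ℝ) ^ (3 / 4 : ℝ)) := by rw [← h3]; ring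
  have h13 : (T : ℝ) * (1 / 2 * (1 / l)) = 1 / 2 * (T : ℝ) ^ (3 / 4 : ℝ) := by
    nth_rewrite 1 [h4]; field_simp
  linarith

end PrimalPath

/-- The regret is of order `√T`, up to a multiple of the accumulated compression error, with
coefficients that depend on the parameters only. -/
theorem exists_netReg_le (n p : ℕ) (R G₁ G₂ L w γ₀ a c₁ c₂ : ℝ) (B : ℕ) :
    ∃ b b' : ℝ, ∀ {m : Fin n → ℕ} {Q : Problem n p m} {G : ℕ → Digraph (Fin n)}
      {W : ℕ → Matrix (Fin n) (Fin n) ℝ} {α : ℕ → ℝ} {z zhat x : Fin n → ℕ → E p},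
      PrimalPath Q R G₁ G₂ L w γ₀ B G W α z zhat x →
      ∀ {T : ℕ}, 1 ≤ T → StepsizeBounds α a c₁ c₂ T → (Q.feasible T).Nonempty →
        Q.netReg x T ≤ (b + b' * totalError z zhat T) * √(T : ℝ) :=
  ⟨_, _, fun h _ hT hα hne => h.netReg_le hT hα hne⟩

theorem exists_netCCV_le (n p : ℕ) (R G₁ G₂ L w γ₀ a c₁ c₂ : ℝ) (B : ℕ) :
    ∃ b b' : ℝ, ∀ {m : Fin n → ℕ} {Q : Problem n p m} {G : ℕ → Digraph (Fin n)}
      {W : ℕ → Matrix (Fin n) (Fin n) ℝ} {α : ℕ → ℝ} {z zhat x : Fin n → ℕ → E p},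
      PrimalPath Q R G₁ G₂ L w γ₀ B G W α z zhat x →
      ∀ {T : ℕ}, 1 ≤ T → StepsizeBounds α a c₁ c₂ T → (Q.feasible T).Nonempty →
        Q.netCCV x T ≤ (b + b' * totalError z zhat T) * (T : ℝ) ^ (3 / 4 : ℝ) := by
  set k := 1 + n * G₂ * consensusConst n B w * (γ₀ * G₂) with hk
  set e := n * G₂ * consensusConst n B w with he
  set u := 4 * n * R ^ 2 + (4 * n * R * G₁ + 2 * n * G₁ ^ 2 * a) * c₁ with hu
  set u' := 1 / 2 + n / (3 * γ₀) * u with hu'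
  refine ⟨k * u' + e * (R + |G₁ * c₁|), k * (n / (3 * γ₀) * (4 * R)) + e, ?_⟩
  intro m Q G W α z zhat x h T hT hα hne
  have hR := h.radius_nonneg
  have hG₂ := h.constraintBound_nonneg
  have hγ := h.penalty_pos
  have hΛ := consensusConst_nonneg n B w
  have hD := totalError_nonneg z zhat T
  have h1 : Q.netCCV x T ≤ k * ∑ t ∈ Finset.range T, ∑ i, violation Q x i (t + 1) +
      e * (R + G₁ * c₁ + totalError z zhat T) * √(T : ℝ) := h.netCCV_le_sum_violation hT hα
  have hk0 : 0 ≤ k := by positivity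
  have he0 : 0 ≤ e := by positivity
  have h2 : k * ∑ t ∈ Finset.range T, ∑ i, violation Q x i (t + 1) ≤
      k * ((1 / 2 + n / (3 * γ₀) * (u + 4 * R * totalError z zhat T)) *
        (T : ℝ) ^ (3 / 4 : ℝ)) :=
    mul_le_mul_of_nonneg_left (h.sum_violation_le hT hα hne) hk0
  have h3 : √(T : ℝ) ≤ (T : ℝ) ^ (3 / 4 : ℝ) := by
    rw [Real.sqrt_eq_rpow]
    exact Real.rpow_le_rpow_of_exponent_le (by exact_mod_cast hT) (by norm_num)
  have h4 : e * (R + G₁ * c₁ + totalError z zhat T) * √(T : ℝ) ≤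
      e * (R + |G₁ * c₁| + totalError z zhat T) * (T : ℝ) ^ (3 / 4 : ℝ) :=
    mul_le_mul (mul_le_mul_of_nonneg_left (by linarith [le_abs_self (G₁ * c₁)]) he0) h3
      (Real.sqrt_nonneg _) (by positivity)
  rw [hu']
  linarith

theorem exists_netCCV_le_of_slater (n p : ℕ) (R G₁ G₂ L w γ₀ a c₁ c₂ : ℝ) (B : ℕ) (c : ℝ) :
    ∃ b b' : ℝ, 0 < c → ∀ {m : Fin n → ℕ} {Q : Problem n p m} {G : ℕ → Digraph (Fin n)}
      {W : ℕ → Matrix (Fin n) (Fin n) ℝ} {α : ℕ → ℝ} {z zhat x : Fin n → ℕ → E p},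
      PrimalPath Q R G₁ G₂ L w γ₀ B G W α z zhat x →
      ∀ {T : ℕ}, 1 ≤ T → StepsizeBounds α a c₁ c₂ T → Q.Slater c →
        Q.netCCV x T ≤ (b + b' * totalError z zhat T) * √(T : ℝ) := by
  set k := 1 + n * G₂ * consensusConst n B w * (γ₀ * G₂) with hk
  set e := n * G₂ * consensusConst n B w with he
  set u := 4 * n * R ^ 2 + (4 * n * R * G₁ + 2 * n * G₁ ^ 2 * a) * c₁ with hu
  refine ⟨k * (1 / (2 * γ₀ * c)) * u + e * (R + G₁ * c₁),
    k * (1 / (2 * γ₀ * c)) * (4 * R) + e, ?_⟩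
  intro hc m Q G W α z zhat x h T hT hα hQ
  have hG₂ := h.constraintBound_nonneg
  have hγ := h.penalty_pos
  have hΛ := consensusConst_nonneg n B w
  have h1 : Q.netCCV x T ≤ k * ∑ t ∈ Finset.range T, ∑ i, violation Q x i (t + 1) +
      e * (R + G₁ * c₁ + totalError z zhat T) * √(T : ℝ) := h.netCCV_le_sum_violation hT hα
  have hk0 : 0 ≤ k := by positivity
  have h2 : k * ∑ t ∈ Finset.range T, ∑ i, violation Q x i (t + 1) ≤
      k * (1 / (2 * γ₀ * c) * ((u + 4 * R * totalError z zhat T) * √(T : ℝ))) :=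
    mul_le_mul_of_nonneg_left (h.sum_violation_le_of_slater hT hα hc hQ) hk0
  linarith

/-! ### Runs of the algorithm as random trajectories -/

theorem IsRun.primalPath {n p : ℕ} {m : Fin n → ℕ} {Q : Problem n p m} {R G₁ G₂ L w γ₀ : ℝ}
    {B : ℕ} {G : ℕ → Digraph (Fin n)} {W : ℕ → Matrix (Fin n) (Fin n) ℝ} {Θ : Type*}
    {comp : E p → Θ → E p} {α s : ℕ → ℝ} {z₁ : Fin n → E p} {θ : Fin n → ℕ → Θ}
    {z zhat x : Fin n → ℕ → E p} {v : (i : Fin n) → ℕ → E (m i)} {dir : Fin n → ℕ → E p}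
    (hrun : IsRun Q W comp α (fun t => γ₀ / α t) s z₁ θ z zhat x v dir)
    (hn : 0 < n) (hX : Q.DecisionSet R) (hQ : Q.Subgradients G₁ G₂) (hL : Q.LipschitzGrad L)
    (hN : Network G W w B) (hw : 0 < w) (hw1 : w ≤ 1) (hγ : 0 < γ₀)
    (hγ' : 4 * G₂ ^ 2 * γ₀ ≤ 1) (hα : ∀ t, 1 ≤ t → 0 < α t) (hz₁ : ∀ i, z₁ i ∈ Q.X) :
    PrimalPath Q R G₁ G₂ L w γ₀ B G W α z zhat x where
  agents_pos := hn
  decisionSet := hX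
  subgradients := hQ
  lipschitzGrad := hL
  network := hN
  weight_pos := hw
  weight_le := hw1
  penalty_pos := hγ
  penalty_le := hγ'
  stepsize_pos := hα
  z_mem i t ht := by
    obtain ⟨t, rfl⟩ := Nat.exists_eq_add_of_le' ht
    rcases t.eq_zero_or_pos with rfl | h
    · rw [zero_add, hrun.z_one i]
      exact hz₁ i
    · rw [hrun.z_step i t h]
      exact setProj_mem ⟨_, hz₁ i⟩ hX.closed hX.convex _
  zhat_mem i t ht := by
    rw [hrun.zhat_step i t ht]
    exact setProj_mem ⟨_, hz₁ i⟩ hX.closed hX.convex _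
  x_step := hrun.x_step
  z_step i t ht := by
    rw [hrun.z_step i t ht, hrun.dir_step i t ht, hrun.v_step i t ht, map_smul, smul_add,
      smul_smul, mul_div_cancel₀ _ (hα t ht).ne']

section Measurability

variable {Ω : Type*} [MeasurableSpace Ω]

theorem measurable_of_coord {ι : Type*} [Fintype ι] {f : Ω → EuclideanSpace ℝ ι}
    (h : ∀ k, Measurable fun ω => f ω k) : Measurable f :=
  (WithLp.measurable_toLp 2 (ι → ℝ)).comp (measurable_pi_iff.2 h)

variable {n p : ℕ} {m : Fin n → ℕ} {Q : Problem n p m} {y : Ω → E p}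

theorem Problem.LipschitzGrad.measurable_gradf {L : ℝ} (h : Q.LipschitzGrad L) (i : Fin n)
    {t : ℕ} (ht : 1 ≤ t) (hy : Measurable y) (hyX : ∀ ω, y ω ∈ Q.X) :
    Measurable fun ω => Q.gradf i t (y ω) := by
  have hlip : LipschitzWith ⟨|L|, abs_nonneg L⟩ (fun u : Q.X => Q.gradf i t u) :=
    LipschitzWith.of_dist_le_mul fun u u' => by
      rw [dist_eq_norm, Subtype.dist_eq, dist_eq_norm]
      exact (h i t ht u u.2 u' u'.2).trans
        (mul_le_mul_of_nonneg_right (le_abs_self L) (norm_nonneg _))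
  exact hlip.continuous.measurable.comp (hy.subtype_mk (h := hyX))

theorem Problem.Subgradients.measurable_constraint {G₁ G₂ : ℝ} (h : Q.Subgradients G₁ G₂) (i : Fin n)
    {t : ℕ} (ht : 1 ≤ t) (hy : Measurable y) (hyX : ∀ ω, y ω ∈ Q.X) :
    Measurable fun ω => Q.g i t (y ω) := by
  refine measurable_of_coord fun k => ?_
  have hone : ∀ u ∈ Q.X, ∀ u' ∈ Q.X, Q.g i t u k - Q.g i t u' k ≤ |G₂| * ‖u - u'‖ := by
    intro u hu u' hu'
    have h1 := h.subgrad_g i t ht u hu u' hu' k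
    have h2 : |Q.gradg i t u (u' - u) k| ≤ G₂ * ‖u' - u‖ :=
      (PiLp.norm_apply_le (Q.gradg i t u (u' - u)) k).trans
        ((ContinuousLinearMap.le_opNorm _ _).trans
          (mul_le_mul_of_nonneg_right (h.bound_g i t ht u hu) (norm_nonneg _)))
    have h3 := mul_le_mul_of_nonneg_right (le_abs_self G₂) (norm_nonneg (u' - u))
    rw [norm_sub_rev u u']
    linarith [neg_le_of_abs_le h2]
  have hlip : LipschitzWith ⟨|G₂|, abs_nonneg G₂⟩ (fun u : Q.X => Q.g i t u k) :=
    LipschitzWith.of_dist_le_mul fun u u' => by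
      rw [Real.dist_eq, Subtype.dist_eq, dist_eq_norm]
      refine abs_sub_le_iff.2 ⟨hone u u.2 u' u'.2, ?_⟩
      rw [norm_sub_rev]
      exact hone u' u'.2 u u.2
  exact hlip.continuous.measurable.comp (hy.subtype_mk (h := hyX))

theorem Problem.Subgradients.measurable_adjoint {G₁ G₂ : ℝ} (h : Q.Subgradients G₁ G₂)
    (i : Fin n) {t : ℕ} (ht : 1 ≤ t) (hy : Measurable y) (hyX : ∀ ω, y ω ∈ Q.X)
    {q : Ω → E (m i)} (hq : Measurable q) :
    Measurable fun ω => (Q.gradg i t (y ω)).adjoint (q ω) := by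
  refine measurable_of_coord fun k => ?_
  have h1 : ∀ ω, (Q.gradg i t (y ω)).adjoint (q ω) k =
      ⟪Q.gradg i t (y ω) (EuclideanSpace.single k 1), q ω⟫_ℝ := fun ω => by
    rw [← ContinuousLinearMap.adjoint_inner_right, EuclideanSpace.inner_single_left]
    simp
  simp only [h1]
  exact ((h.measurable_g i t ht _).comp (hy.subtype_mk (h := hyX))).inner hq

variable {R G₁ G₂ L w γ₀ : ℝ} {B : ℕ} {G : ℕ → Digraph (Fin n)}
  {W : ℕ → Matrix (Fin n) (Fin n) ℝ} {α : ℕ → ℝ}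
  {z zhat x : Ω → Fin n → ℕ → E p}

/-- The iterates at iteration `τ`, before its compression, are functions of the randomness of the
earlier iterations: they are measurable for every σ-algebra for which that randomness is. -/
theorem measurable_iterates {Θ : Type*} [MeasurableSpace Θ] {comp : E p → Θ → E p}
    (hcomp : Measurable (Function.uncurry comp)) {γ s : ℕ → ℝ} {z₁ : Fin n → E p}
    {ξ : Fin n → ℕ → Ω → Θ} {v : Ω → (i : Fin n) → ℕ → E (m i)} {dir : Ω → Fin n → ℕ → E p}
    (hrun : ∀ ω, IsRun Q W comp α γ s z₁ (fun i t => ξ i t ω) (z ω) (zhat ω) (x ω) (v ω) (dir ω))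
    (hpath : ∀ ω, PrimalPath Q R G₁ G₂ L w γ₀ B G W α (z ω) (zhat ω) (x ω))
    (hX : Q.DecisionSet R) (hQ : Q.Subgradients G₁ G₂) (hL : Q.LipschitzGrad L)
    (hne : Q.X.Nonempty) {τ : ℕ}
    (hξ : ∀ j k, 1 ≤ k → k < τ + 1 → Measurable (ξ j k)) :
    (∀ i, Measurable fun ω => z ω i (τ + 1)) ∧ ∀ i, Measurable fun ω => zhat ω i τ := by
  induction τ with
  | zero =>
    refine ⟨fun i => ?_, fun i => ?_⟩
    · simp only [zero_add, (hrun _).z_one]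
      exact measurable_const
    · simp only [(hrun _).zhat_zero]
      exact measurable_const
  | succ τ ih =>
    obtain ⟨hz, hzhat⟩ := ih fun j k hk hkτ => hξ j k hk (by omega)
    have hP := measurable_setProj hne hX.closed hX.convex
    have ht : 1 ≤ τ + 1 := by omega
    have h1 : ∀ i, Measurable fun ω => zhat ω i (τ + 1) := by
      intro i
      simp only [(hrun _).zhat_step i (τ + 1) ht, Nat.add_sub_cancel]
      have hin : Measurable fun ω => (s (τ + 1))⁻¹ • (z ω i (τ + 1) - zhat ω i τ) :=
        ((hz i).sub (hzhat i)).const_smul (s (τ + 1))⁻¹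
      have hout : Measurable fun ω =>
          comp ((s (τ + 1))⁻¹ • (z ω i (τ + 1) - zhat ω i τ)) (ξ i (τ + 1) ω) :=
        hcomp.comp (hin.prodMk (hξ i (τ + 1) ht (by omega)))
      exact hP.comp ((hzhat i).add (hout.const_smul (s (τ + 1))))
    have h2 : ∀ i, Measurable fun ω => x ω i (τ + 1) := by
      intro i
      simp only [(hrun _).x_step i (τ + 1) ht]
      refine Finset.measurable_sum _ fun j _ => ?_
      exact (h1 j).const_smul (W (τ + 1) i j)
    refine ⟨fun i => ?_, h1⟩
    simp only [(hpath _).z_step i (τ + 1) ht]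
    have hxX : ∀ ω, x ω i (τ + 1) ∈ Q.X := fun ω => (hpath ω).x_mem i ht
    have h3 := hL.measurable_gradf i ht (h2 i) hxX
    have h4 := hQ.measurable_adjoint i ht (h2 i) hxX
      (measurable_posVec.comp (hQ.measurable_constraint i ht (h2 i) hxX))
    exact hP.comp ((h2 i).sub ((h3.const_smul (α (τ + 1))).add (h4.const_smul γ₀)))

end Measurability

/-! ### The expected compression error -/

theorem measurable_vecNorm {p : ℕ} {d : ℝ≥0∞} (hd : 1 ≤ d) :
    Measurable (vecNorm d : E p → ℝ) := by
  have : Fact (1 ≤ d) := ⟨hd⟩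
  have h : Continuous fun x : E p => (WithLp.toLp d (fun k => x k) : PiLp d fun _ : Fin p => ℝ) :=
    (PiLp.continuous_toLp d _).comp (by fun_prop)
  exact h.norm.measurable

/-- The error of the compressor at an independent random input. -/
theorem Compressor.lintegral_le {p : ℕ} {Θ Ω : Type*} [MeasurableSpace Θ] [MeasurableSpace Ω]
    {comp : E p → Θ → E p} {ν : Measure Θ} [IsProbabilityMeasure ν] {d : ℝ≥0∞} {C : ℝ}
    (h : Compressor comp ν d C) (hd : 1 ≤ d) (hC : 0 ≤ C) {P : Measure Ω}
    [IsProbabilityMeasure P] {ζ : Ω → Θ} {u : Ω → E p} (hζ : Measurable ζ) (hu : Measurable u)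
    (hlaw : P.map ζ = ν) (hind : IndepFun ζ u P) :
    ∫⁻ ω, ENNReal.ofReal ‖comp (u ω) (ζ ω) - u ω‖ ∂P ≤ ENNReal.ofReal (p * (1 + C)) := by
  set F : E p × Θ → ℝ≥0∞ := fun q =>
    1 + ENNReal.ofReal (vecNorm d (comp q.1 q.2 - q.1) ^ 2) with hF
  have hFm : Measurable F := by
    refine measurable_const.add (ENNReal.measurable_ofReal.comp (Measurable.pow_const ?_ 2))
    exact (measurable_vecNorm hd).comp (h.measurable.sub measurable_fst)
  have hle : ∀ ω, ENNReal.ofReal ‖comp (u ω) (ζ ω) - u ω‖ ≤ p * F (u ω, ζ ω) := by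
    intro ω
    set e := comp (u ω) (ζ ω) - u ω with he
    have h1 : ‖e‖ ≤ p * (1 + vecNorm d e ^ 2) :=
      (norm_le_mul_vecNorm hd e).trans (mul_le_mul_of_nonneg_left
        (by nlinarith [sq_nonneg (vecNorm d e - 1), sq_nonneg (vecNorm d e)]) (Nat.cast_nonneg p))
    refine (ENNReal.ofReal_le_ofReal h1).trans_eq ?_
    rw [ENNReal.ofReal_mul (Nat.cast_nonneg p), ENNReal.ofReal_natCast,
      ENNReal.ofReal_add zero_le_one (sq_nonneg _), ENNReal.ofReal_one]
  have hprod : P.map (fun ω => (u ω, ζ ω)) = (P.map u).prod ν := by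
    rw [(indepFun_iff_map_prod_eq_prod_map_map hu.aemeasurable hζ.aemeasurable).1 hind.symm, hlaw]
  have : IsProbabilityMeasure (P.map u) := Measure.isProbabilityMeasure_map hu.aemeasurable
  calc ∫⁻ ω, ENNReal.ofReal ‖comp (u ω) (ζ ω) - u ω‖ ∂P
      ≤ ∫⁻ ω, p * F (u ω, ζ ω) ∂P := lintegral_mono hle
    _ = p * ∫⁻ ω, F (u ω, ζ ω) ∂P := lintegral_const_mul _ (hFm.comp (hu.prodMk hζ))
    _ = p * ∫⁻ q, F q ∂((P.map u).prod ν) := by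
        rw [← hprod, lintegral_map hFm (hu.prodMk hζ)]
    _ = p * ∫⁻ y, ∫⁻ θ, F (y, θ) ∂ν ∂(P.map u) := by
        rw [lintegral_prod _ hFm.aemeasurable]
    _ ≤ p * ∫⁻ _, (1 + ENNReal.ofReal C) ∂(P.map u) := by
        gcongr with y
        rw [lintegral_add_left measurable_const, lintegral_const, measure_univ, mul_one]
        gcongr
        exact h.error y
    _ = ENNReal.ofReal (p * (1 + C)) := by
        rw [lintegral_const, measure_univ, mul_one, ENNReal.ofReal_mul (Nat.cast_nonneg p),
          ENNReal.ofReal_natCast, ENNReal.ofReal_add zero_le_one hC, ENNReal.ofReal_one]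

/-- The projection brings the broadcast point closer to `z`, so that its error is at most the
scaled error of the compressor. -/
theorem IsRun.norm_zhat_sub_z_le {n p : ℕ} {m : Fin n → ℕ} {Q : Problem n p m} {R : ℝ}
    {W : ℕ → Matrix (Fin n) (Fin n) ℝ} {Θ : Type*} {comp : E p → Θ → E p} {α γ s : ℕ → ℝ}
    {z₁ : Fin n → E p} {θ : Fin n → ℕ → Θ} {z zhat x : Fin n → ℕ → E p}
    {v : (i : Fin n) → ℕ → E (m i)} {dir : Fin n → ℕ → E p}
    (hrun : IsRun Q W comp α γ s z₁ θ z zhat x v dir) (hX : Q.DecisionSet R) (i : Fin n) {t : ℕ}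
    (hs : 0 < s (t + 1)) (hz : z i (t + 1) ∈ Q.X) :
    ‖zhat i (t + 1) - z i (t + 1)‖ ≤ s (t + 1) *
      ‖comp ((s (t + 1))⁻¹ • (z i (t + 1) - zhat i t)) (θ i (t + 1)) -
        (s (t + 1))⁻¹ • (z i (t + 1) - zhat i t)‖ := by
  rw [hrun.zhat_step i (t + 1) (by omega), Nat.add_sub_cancel]
  refine (norm_setProj_sub_le hX.closed hX.convex _ hz).trans_eq ?_
  rw [← Real.norm_of_nonneg hs.le, ← norm_smul, Real.norm_of_nonneg hs.le,
    smul_sub (s (t + 1)) (comp _ _), smul_inv_smul₀ hs.ne']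
  congr 1
  abel

section Expectation

variable {n p : ℕ} {m : Fin n → ℕ} {Q : Problem n p m} {R G₁ G₂ L w γ₀ : ℝ} {B : ℕ}
  {G : ℕ → Digraph (Fin n)} {W : ℕ → Matrix (Fin n) (Fin n) ℝ} {α : ℕ → ℝ}
  {Ω Θ : Type*} [MeasurableSpace Θ] [MeasurableSpace Ω] {comp : E p → Θ → E p}
  {P : Measure Ω} [IsProbabilityMeasure P] {z zhat x : Ω → Fin n → ℕ → E p}

/-- The input of the compressor is a function of the earlier randomness, so that the error bound
applies conditionally on it. -/
theorem integral_norm_zhat_sub_z_le {ν : Measure Θ} [IsProbabilityMeasure ν] {d : ℝ≥0∞} {C : ℝ}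
    (hcomp : Compressor comp ν d C) (hd : 1 ≤ d) (hC : 0 ≤ C) {γ s : ℕ → ℝ} {z₁ : Fin n → E p}
    {ξ : Fin n → ℕ → Ω → Θ} (hξ : FreshRandomness P ν ξ)
    {v : Ω → (i : Fin n) → ℕ → E (m i)} {dir : Ω → Fin n → ℕ → E p}
    (hrun : ∀ ω, IsRun Q W comp α γ s z₁ (fun i t => ξ i t ω) (z ω) (zhat ω) (x ω) (v ω) (dir ω))
    (hpath : ∀ ω, PrimalPath Q R G₁ G₂ L w γ₀ B G W α (z ω) (zhat ω) (x ω))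
    (hX : Q.DecisionSet R) (hQ : Q.Subgradients G₁ G₂) (hL : Q.LipschitzGrad L)
    (hne : Q.X.Nonempty) (i : Fin n) (t : ℕ) (hs : 0 < s (t + 1)) :
    ∫ ω, ‖zhat ω i (t + 1) - z ω i (t + 1)‖ ∂P ≤ s (t + 1) * (p * (1 + C)) := by
  obtain ⟨hz, hzhat⟩ := measurable_iterates hcomp.measurable hrun hpath hX hQ hL hne
    (τ := t) fun j k _ _ => hξ.measurable j k
  obtain ⟨-, hzhat'⟩ := measurable_iterates hcomp.measurable hrun hpath hX hQ hL hne
    (τ := t + 1) fun j k _ _ => hξ.measurable j k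
  set u : Ω → E p := fun ω => (s (t + 1))⁻¹ • (z ω i (t + 1) - zhat ω i t) with hu
  have hum : Measurable u := ((hz i).sub (hzhat i)).const_smul (s (t + 1))⁻¹
  have hind : IndepFun (ξ i (t + 1)) u P := by
    set past : Ω → Fin n × Finset.Ico 1 (t + 1) → Θ := fun ω q => ξ q.1 q.2 ω with hpast
    have h1 := hξ.indep i (t + 1) (by omega)
    rw [IndepFun_iff_Indep] at h1 ⊢
    refine indep_of_indep_of_le_right h1 (Measurable.comap_le ?_)
    -- the iterates are measurable for the σ-algebra of the earlier randomness
    obtain ⟨h2, h3⟩ := @measurable_iterates Ω (MeasurableSpace.comap past inferInstance)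
      n p m Q R G₁ G₂ L w γ₀ B G W α z zhat x Θ _ comp hcomp.measurable γ s z₁ ξ v dir hrun hpath
      hX hQ hL hne t fun j k hk hkt =>
        (measurable_pi_apply (⟨j, ⟨k, Finset.mem_Ico.2 ⟨hk, hkt⟩⟩⟩ :
          Fin n × Finset.Ico 1 (t + 1))).comp (comap_measurable past)
    exact ((h2 i).sub (h3 i)).const_smul (s (t + 1))⁻¹
  have hbound := hcomp.lintegral_le hd hC (hξ.measurable i (t + 1)) hum
    (hξ.law i (t + 1) (by omega)) hind
  have herrm : Measurable fun ω => ‖zhat ω i (t + 1) - z ω i (t + 1)‖ :=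
    ((hzhat' i).sub (hz i)).norm
  rw [integral_eq_lintegral_of_nonneg_ae (ae_of_all _ fun _ => norm_nonneg _)
    herrm.aestronglyMeasurable]
  refine ENNReal.toReal_le_of_le_ofReal (by positivity) ?_
  calc ∫⁻ ω, ENNReal.ofReal ‖zhat ω i (t + 1) - z ω i (t + 1)‖ ∂P
      ≤ ∫⁻ ω, ENNReal.ofReal (s (t + 1)) *
          ENNReal.ofReal ‖comp (u ω) (ξ i (t + 1) ω) - u ω‖ ∂P := by
        refine lintegral_mono fun ω => ?_
        rw [← ENNReal.ofReal_mul hs.le]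
        exact ENNReal.ofReal_le_ofReal
          ((hrun ω).norm_zhat_sub_z_le hX i hs ((hpath ω).z_mem i (t + 1) (by omega)))
    _ = ENNReal.ofReal (s (t + 1)) *
          ∫⁻ ω, ENNReal.ofReal ‖comp (u ω) (ξ i (t + 1) ω) - u ω‖ ∂P :=
        lintegral_const_mul' _ _ ENNReal.ofReal_ne_top
    _ ≤ ENNReal.ofReal (s (t + 1)) * ENNReal.ofReal (p * (1 + C)) := by gcongr
    _ = _ := (ENNReal.ofReal_mul hs.le).symm

theorem integrable_norm_zhat_sub_z
    (hpath : ∀ ω, PrimalPath Q R G₁ G₂ L w γ₀ B G W α (z ω) (zhat ω) (x ω))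
    (hz : ∀ i t, Measurable fun ω => z ω i (t + 1))
    (hzhat : ∀ i t, Measurable fun ω => zhat ω i (t + 1)) (i : Fin n) (t : ℕ) :
    Integrable (fun ω => ‖zhat ω i (t + 1) - z ω i (t + 1)‖) P := by
  refine Integrable.of_bound ((hzhat i t).sub (hz i t)).norm.aestronglyMeasurable (2 * R)
    (ae_of_all _ fun ω => ?_)
  rw [norm_norm]
  exact (hpath ω).decisionSet.norm_sub_le ((hpath ω).zhat_mem i _ (by omega))
    ((hpath ω).z_mem i _ (by omega))

theorem integrable_totalError
    (hpath : ∀ ω, PrimalPath Q R G₁ G₂ L w γ₀ B G W α (z ω) (zhat ω) (x ω))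
    (hz : ∀ i t, Measurable fun ω => z ω i (t + 1))
    (hzhat : ∀ i t, Measurable fun ω => zhat ω i (t + 1)) (T : ℕ) :
    Integrable (fun ω => totalError (z ω) (zhat ω) T) P :=
  integrable_finsetSum _ fun t _ => integrable_finsetSum _ fun i _ =>
    integrable_norm_zhat_sub_z hpath hz hzhat i t

theorem integral_totalError_le
    (hpath : ∀ ω, PrimalPath Q R G₁ G₂ L w γ₀ B G W α (z ω) (zhat ω) (x ω))
    (hz : ∀ i t, Measurable fun ω => z ω i (t + 1))
    (hzhat : ∀ i t, Measurable fun ω => zhat ω i (t + 1)) {s₀ μ b : ℝ} (hs₀ : 0 < s₀)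
    (h0 : 0 < μ) (h1 : μ < 1) (hb : 0 ≤ b)
    (hle : ∀ i t, ∫ ω, ‖zhat ω i (t + 1) - z ω i (t + 1)‖ ∂P ≤ s₀ * μ ^ (t + 1) * b) (T : ℕ) :
    ∫ ω, totalError (z ω) (zhat ω) T ∂P ≤ n * (s₀ * b) * (1 / (1 - μ)) := by
  have hint := integrable_norm_zhat_sub_z (P := P) hpath hz hzhat
  have h2 : ∫ ω, totalError (z ω) (zhat ω) T ∂P = ∑ t ∈ Finset.range (T + 1), ∑ i,
      ∫ ω, ‖zhat ω i (t + 1) - z ω i (t + 1)‖ ∂P := by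
    simp only [totalError, compressionError]
    rw [integral_finsetSum _ fun t _ => integrable_finsetSum _ fun i _ => hint i t]
    exact Finset.sum_congr rfl fun t _ => integral_finsetSum _ fun i _ => hint i t
  rw [h2]
  calc _ ≤ ∑ t ∈ Finset.range (T + 1), ∑ _i : Fin n, s₀ * μ ^ (t + 1) * b :=
        Finset.sum_le_sum fun t _ => Finset.sum_le_sum fun i _ => hle i t
    _ = n * (s₀ * b) * ∑ t ∈ Finset.range (T + 1), μ ^ (t + 1) := by
        rw [Finset.mul_sum]
        refine Finset.sum_congr rfl fun t _ => ?_
        rw [Finset.sum_const, Finset.card_univ, Fintype.card_fin, nsmul_eq_mul]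
        ring
    _ ≤ _ := mul_le_mul_of_nonneg_left (sum_range_pow_succ_le h0 h1 _) (by positivity)

theorem integral_le_of_le_mul {f D : Ω → ℝ} {b b' c r : ℝ} (hf : Integrable f P)
    (hD : Integrable D P) (hD0 : ∀ ω, 0 ≤ D ω) (hc : ∫ ω, D ω ∂P ≤ c) (hr : 0 ≤ r)
    (hle : ∀ ω, f ω ≤ (b + b' * D ω) * r) : ∫ ω, f ω ∂P ≤ (b + |b'| * c) * r := by
  have hint : Integrable (fun ω => (b + b' * D ω) * r) P :=
    ((integrable_const b).add (hD.const_mul b')).mul_const r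
  refine (integral_mono hf hint hle).trans ?_
  rw [integral_mul_const, integral_add (integrable_const b) (hD.const_mul b'),
    integral_const_mul, integral_const, probReal_univ, one_smul]
  refine mul_le_mul_of_nonneg_right (add_le_add le_rfl ?_) hr
  exact (mul_le_mul_of_nonneg_right (le_abs_self b') (integral_nonneg hD0)).trans
    (mul_le_mul_of_nonneg_left hc (abs_nonneg b'))

/-! ### Integrability of regret and constraint violation -/

/-- The infimum of a linear functional over a bounded set is Lipschitz in the functional. -/
theorem lipschitzWith_iInf_inner {S : Set (E p)} (hS : S.Nonempty) (hR : 0 ≤ R)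
    (hSR : ∀ y ∈ S, ‖y‖ ≤ R) :
    LipschitzWith ⟨R, hR⟩ fun u : E p => ⨅ y : S, ⟪u, (y : E p)⟫_ℝ := by
  have : Nonempty S := hS.to_subtype
  have hin : ∀ (u : E p) (y : S), |⟪u, (y : E p)⟫_ℝ| ≤ R * ‖u‖ := fun u y => by
    rw [mul_comm]
    exact (abs_real_inner_le_norm _ _).trans
      (mul_le_mul_of_nonneg_left (hSR y y.2) (norm_nonneg _))
  have hbdd : ∀ u : E p, BddBelow (Set.range fun y : S => ⟪u, (y : E p)⟫_ℝ) := fun u =>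
    ⟨-(R * ‖u‖), by rintro _ ⟨y, rfl⟩; exact neg_le_of_abs_le (hin u y)⟩
  have key : ∀ u u' : E p, (⨅ y : S, ⟪u, (y : E p)⟫_ℝ) - R * ‖u - u'‖ ≤
      ⨅ y : S, ⟪u', (y : E p)⟫_ℝ := fun u u' => by
    refine le_ciInf fun y => ?_
    have h1 := ciInf_le (hbdd u) y
    have h2 := (le_abs_self _).trans (hin (u - u') y)
    rw [inner_sub_left] at h2
    linarith
  refine LipschitzWith.of_dist_le_mul fun u u' => ?_
  rw [Real.dist_eq, dist_eq_norm]
  refine abs_sub_le_iff.2 ⟨?_, ?_⟩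
  · have := key u u'
    change _ ≤ R * _
    linarith
  · have := key u' u
    rw [norm_sub_rev] at this
    change _ ≤ R * _
    linarith

theorem measurable_globalGrad {y : Ω → E p} (hL : Q.LipschitzGrad L) {t : ℕ} (ht : 1 ≤ t)
    (hy : Measurable y) (hyX : ∀ ω, y ω ∈ Q.X) : Measurable fun ω => Q.globalGrad t (y ω) := by
  have h : Measurable fun ω => ∑ j, Q.gradf j t (y ω) :=
    Finset.measurable_sum _ fun j _ => hL.measurable_gradf j ht hy hyX
  exact h.const_smul (1 / (n : ℝ))

theorem norm_globalGrad_le (hn : 0 < n) (hQ : Q.Subgradients G₁ G₂) {t : ℕ} (ht : 1 ≤ t)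
    {y : E p} (hy : y ∈ Q.X) : ‖Q.globalGrad t y‖ ≤ G₁ := by
  have hn' : (0 : ℝ) < n := Nat.cast_pos.2 hn
  rw [Problem.globalGrad, norm_smul, Real.norm_of_nonneg (by positivity), one_div_mul_eq_div,
    div_le_iff₀ hn']
  refine (norm_sum_le _ _).trans ((Finset.sum_le_sum fun j _ => hQ.bound_f j t ht y hy).trans_eq ?_)
  rw [Finset.sum_const, Finset.card_univ, Fintype.card_fin, nsmul_eq_mul, mul_comm]

theorem integrable_netReg (hn : 0 < n) (hX : Q.DecisionSet R) (hQ : Q.Subgradients G₁ G₂)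
    (hL : Q.LipschitzGrad L) {T : ℕ} (hne : (Q.feasible T).Nonempty)
    (hx : ∀ i t, Measurable fun ω => x ω i (t + 1)) (hxX : ∀ ω i t, x ω i (t + 1) ∈ Q.X) :
    Integrable (fun ω => Q.netReg (x ω) T) P := by
  have hR : 0 ≤ R := (norm_nonneg _).trans (hX.bounded _ hne.some_mem.1)
  have hG₁ : 0 ≤ G₁ := (norm_nonneg _).trans
    (hQ.bound_f ⟨0, hn⟩ 1 le_rfl _ hne.some_mem.1)
  have hlip := lipschitzWith_iInf_inner hne hR fun y hy => hX.bounded y hy.1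
  have hg : ∀ i t, Measurable fun ω => Q.globalGrad (t + 1) (x ω i (t + 1)) := fun i t =>
    measurable_globalGrad hL (by omega) (hx i t) fun ω => hxX ω i t
  have hgb : ∀ ω i t, ‖Q.globalGrad (t + 1) (x ω i (t + 1))‖ ≤ G₁ := fun ω i t =>
    norm_globalGrad_le hn hQ (by omega) (hxX ω i t)
  simp only [Problem.netReg, sum_Icc_one_eq_sum_range]
  refine (integrable_finsetSum _ fun i _ => Integrable.sub
    (integrable_finsetSum _ fun t _ => ?_) ?_).const_mul _
  · refine Integrable.of_bound ((hg i t).inner (hx i t)).aestronglyMeasurable (G₁ * R)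
      (ae_of_all _ fun ω => ?_)
    exact (norm_inner_le_norm _ _).trans
      (mul_le_mul (hgb ω i t) (hX.bounded _ (hxX ω i t)) (norm_nonneg _) hG₁)
  · have hs : Measurable fun ω => ∑ t ∈ Finset.range T, Q.globalGrad (t + 1) (x ω i (t + 1)) :=
      Finset.measurable_sum _ fun t _ => hg i t
    refine Integrable.of_bound (hlip.continuous.measurable.comp hs).aestronglyMeasurable
      (R * (T * G₁)) (ae_of_all _ fun ω => ?_)
    have h1 := hlip.dist_le_mul
      (∑ t ∈ Finset.range T, Q.globalGrad (t + 1) (x ω i (t + 1))) 0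
    have : Nonempty (Q.feasible T) := hne.to_subtype
    simp only [inner_zero_left, ciInf_const, dist_zero_right] at h1
    refine h1.trans (mul_le_mul_of_nonneg_left ?_ hR)
    refine (norm_sum_le _ _).trans ((Finset.sum_le_sum fun t _ => hgb ω i t).trans_eq ?_)
    rw [Finset.sum_const, Finset.card_range, nsmul_eq_mul]

theorem integrable_netCCV (hn : 0 < n) (hX : Q.DecisionSet R) (hQ : Q.Subgradients G₁ G₂)
    {T : ℕ} (hne : Q.X.Nonempty)
    (hx : ∀ i t, Measurable fun ω => x ω i (t + 1)) (hxX : ∀ ω i t, x ω i (t + 1) ∈ Q.X) :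
    Integrable (fun ω => Q.netCCV (x ω) T) P := by
  obtain ⟨y, hy⟩ := hne
  have hG₂ : 0 ≤ G₂ := (norm_nonneg _).trans (hQ.bound_g ⟨0, hn⟩ 1 le_rfl _ hy)
  simp only [Problem.netCCV, sum_Icc_one_eq_sum_range]
  refine (integrable_finsetSum _ fun i _ => integrable_finsetSum _ fun t _ => ?_).const_mul _
  have hm : Measurable fun ω => Q.globalConstraint (t + 1) (x ω i (t + 1)) := by
    refine measurable_of_coord fun k => ?_
    exact (measurable_pi_iff.1 ((WithLp.measurable_ofLp 2 _).comp
      (hQ.measurable_constraint k.1 (by omega) (hx i t) fun ω => hxX ω i t))) k.2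
  refine Integrable.of_bound (measurable_posVec.comp hm).norm.aestronglyMeasurable
    (∑ j, (‖posVec (Q.g j (t + 1) y)‖ + G₂ * (2 * R))) (ae_of_all _ fun ω => ?_)
  rw [norm_norm]
  refine (norm_posVec_globalConstraint_le _ _ _).trans (Finset.sum_le_sum fun j _ => ?_)
  exact (hQ.norm_posVec_le j (by omega) (hxX ω i t) hy).trans (add_le_add le_rfl
    (mul_le_mul_of_nonneg_left (hX.norm_sub_le (hxX ω i t) hy) hG₂))

end Expectation

theorem stepsizeBounds_stepsize {α₀ μ : ℝ} (hα₀ : 0 < α₀) (h0 : 0 < μ) (h1 : μ < 1) {T : ℕ}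
    (hT : 1 ≤ T) :
    StepsizeBounds (stepsize α₀ μ) (α₀ * √(1 / (1 - μ))) (2 * (α₀ * √(1 / (1 - μ))))
      (1 / (α₀ * √μ)) T where
  antitone := stepsize_antitone hα₀ h0 h1
  le := stepsize_le hα₀ h0 h1
  sum_le := sum_stepsize_le hα₀ h0 h1 T
  inv_le := by
    obtain ⟨t, rfl⟩ := Nat.exists_eq_add_of_le' hT
    exact one_div_stepsize_le hα₀ h0 t

end OnlineOpt

end

theorem theorem2 (n p : ℕ) (hn : 0 < n) (m : Fin n → ℕ)
    (R G₁ G₂ L w : ℝ) (hw : 0 < w ∧ w < 1) (B : ℕ) (hB : 0 < B)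
    (d : ℝ≥0∞) (hd : 1 ≤ d) (C : ℝ) (hC : 0 ≤ C)
    (α₀ γ₀ s₀ μ : ℝ) (hα₀ : 0 < α₀)
    -- `γ₀ ≤ 1 / (4 G₂²)`, which is no condition if `G₂ = 0`
    (hγ₀ : 0 < γ₀ ∧ 4 * G₂ ^ 2 * γ₀ ≤ 1)
    (hs₀ : 0 < s₀) (hμ : 0 < μ ∧ μ < 1) :
    ∃ (K₁ K₂ : ℝ) (K₃ : ℝ → ℝ),
      ∀ (Q : Problem n p m), Q.DecisionSet R → Q.Subgradients G₁ G₂ → Q.LipschitzGrad L →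
        (∀ T, 1 ≤ T → (Q.feasible T).Nonempty) →
      ∀ (G : ℕ → Digraph (Fin n)) (W : ℕ → Matrix (Fin n) (Fin n) ℝ), Network G W w B →
      ∀ (Θ : Type*) [MeasurableSpace Θ] (ν : Measure Θ) [IsProbabilityMeasure ν]
        (comp : E p → Θ → E p), Compressor comp ν d C →
      ∀ (Ω : Type*) [MeasurableSpace Ω] (P : Measure Ω) [IsProbabilityMeasure P]
        (ξ : Fin n → ℕ → Ω → Θ), FreshRandomness P ν ξ →
      ∀ (z₁ : Fin n → E p), (∀ i, z₁ i ∈ Q.X) →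
      ∀ (x : Ω → Fin n → ℕ → E p),
        (∀ ω, IsOutput Q W comp (stepsize α₀ μ) (fun t => γ₀ / stepsize α₀ μ t)
          (fun t => s₀ * μ ^ t) z₁ (fun i t => ξ i t ω) (x ω)) →
      ∀ T : ℕ, 1 ≤ T →
        Integrable (fun ω => Q.netReg (x ω) T) P ∧
        Integrable (fun ω => Q.netCCV (x ω) T) P ∧
        ∫ ω, Q.netReg (x ω) T ∂P ≤ K₁ * √(T : ℝ) ∧
        ∫ ω, Q.netCCV (x ω) T ∂P ≤ K₂ * (T : ℝ) ^ (3 / 4 : ℝ) ∧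
        ∀ ς : ℝ, 0 < ς → Q.Slater ς →
          ∫ ω, Q.netCCV (x ω) T ∂P ≤ K₃ ς * √(T : ℝ) := by
  set a := α₀ * √(1 / (1 - μ)) with ha
  set c₂ := 1 / (α₀ * √μ) with hc₂
  set D := n * (s₀ * (p * (1 + C))) * (1 / (1 - μ)) with hD
  obtain ⟨b, b', hreg⟩ := exists_netReg_le n p R G₁ G₂ L w γ₀ a (2 * a) c₂ B
  obtain ⟨e, e', hccv⟩ := exists_netCCV_le n p R G₁ G₂ L w γ₀ a (2 * a) c₂ B
  choose q q' hslater using exists_netCCV_le_of_slater n p R G₁ G₂ L w γ₀ a (2 * a) c₂ B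
  refine ⟨b + |b'| * D, e + |e'| * D, fun ς => q ς + |q' ς| * D, ?_⟩
  intro Q hX hQ hL hfeas G W hN Θ _ ν _ comp hcomp Ω _ P _ ξ hξ z₁ hz₁ x hx T hT
  have hx' : ∀ ω, ∃ z zhat v dir, IsRun Q W comp (stepsize α₀ μ)
      (fun t => γ₀ / stepsize α₀ μ t) (fun t => s₀ * μ ^ t) z₁ (fun i t => ξ i t ω)
      z zhat (x ω) v dir := hx
  choose z zhat v dir hrun using hx'
  have hstep : ∀ t, 1 ≤ t → 0 < stepsize α₀ μ t := fun t ht => by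
    obtain ⟨t, rfl⟩ := Nat.exists_eq_add_of_le' ht
    exact stepsize_pos hα₀ hμ.1 t
  have hpath : ∀ ω, PrimalPath Q R G₁ G₂ L w γ₀ B G W (stepsize α₀ μ) (z ω) (zhat ω) (x ω) :=
    fun ω => (hrun ω).primalPath hn hX hQ hL hN hw.1 hw.2.le hγ₀.1 hγ₀.2 hstep hz₁
  have hne : Q.X.Nonempty := ⟨_, hz₁ ⟨0, hn⟩⟩
  have hmeas : ∀ τ, (∀ i, Measurable fun ω => z ω i (τ + 1)) ∧
      ∀ i, Measurable fun ω => zhat ω i τ := fun τ =>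
    measurable_iterates hcomp.measurable hrun hpath hX hQ hL hne fun j k _ _ => hξ.measurable j k
  have hz : ∀ i t, Measurable fun ω => z ω i (t + 1) := fun i t => (hmeas t).1 i
  have hzhat : ∀ i t, Measurable fun ω => zhat ω i (t + 1) := fun i t => (hmeas (t + 1)).2 i
  have hxm : ∀ i t, Measurable fun ω => x ω i (t + 1) := fun i t => by
    simp only [(hrun _).x_step i (t + 1) (by omega)]
    refine Finset.measurable_sum _ fun j _ => ?_
    exact (hzhat j t).const_smul (W (t + 1) i j)
  have hxX : ∀ ω i t, x ω i (t + 1) ∈ Q.X := fun ω i t => (hpath ω).x_mem i (by omega)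
  have herr : ∫ ω, totalError (z ω) (zhat ω) T ∂P ≤ D :=
    integral_totalError_le hpath hz hzhat hs₀ hμ.1 hμ.2 (by positivity)
      (fun i t => integral_norm_zhat_sub_z_le hcomp hd hC hξ hrun hpath hX hQ hL hne i t
        (mul_pos hs₀ (pow_pos hμ.1 _))) T
  have herr_int := integrable_totalError (P := P) hpath hz hzhat T
  have hα := stepsizeBounds_stepsize hα₀ hμ.1 hμ.2 hT
  have hreg_int : Integrable (fun ω => Q.netReg (x ω) T) P :=
    integrable_netReg hn hX hQ hL (hfeas T hT) hxm hxX
  have hccv_int : Integrable (fun ω => Q.netCCV (x ω) T) P :=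
    integrable_netCCV hn hX hQ hne hxm hxX
  have h0 := fun ω => totalError_nonneg (z ω) (zhat ω) T
  refine ⟨hreg_int, hccv_int, ?_, ?_, fun ς hς hS => ?_⟩
  · exact integral_le_of_le_mul hreg_int herr_int h0 herr (Real.sqrt_nonneg _)
      fun ω => hreg (hpath ω) hT hα (hfeas T hT)
  · exact integral_le_of_le_mul hccv_int herr_int h0 herr (by positivity)
      fun ω => hccv (hpath ω) hT hα (hfeas T hT)
  · exact integral_le_of_le_mul hccv_int herr_int h0 herr (Real.sqrt_nonneg _)
      fun ω => hslater ς hς (hpath ω) hT hα hS
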